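/- For $\tau$ in the upper half plane and $z\in\mathbb C$ put $q^x=e^{2\pi i\tau x}$ and define, wherever no denominator vanishes, $$f_1(\tau,z)=\sum_{j\in\mathbb Z}\frac{e^{2\pi ijz}q^{\frac12j^2}}{1-e^{2\pi iz}q^j},\quad f_2(\tau,z)=\sum_{j\in\mathbb Z}(-1)^j\frac{e^{2\pi i(j+\frac12)z}q^{\frac12(j+\frac12)^2}}{1+e^{2\pi iz}q^{j+\frac12}},$$ $$f_3(\tau,z)=\sum_{j\in\mathbb Z}(-1)^j\frac{e^{2\pi ijz}q^{\frac12j^2}}{1+e^{2\pi iz}q^j},\quad f_4(\tau,z)=\sum_{j\in\mathbb Z}\frac{e^{2\pi i(j+\frac12)z}q^{\frac12(j+\frac12)^2}}{1-e^{2\pi iz}q^{j+\frac12}},$$ $$g_1(\tau,z)=\sum_{j\in\mathbb Z}\frac{e^{2\pi i(j-\frac12)z}q^{\frac12j(j-1)}}{1-e^{2\pi iz}q^j},\quad g_2(\tau,z)=\sum_{j\in\mathbb Z}(-1)^j\frac{e^{2\pi i(j-\frac12)z}q^{\frac12j(j-1)}}{1+e^{2\pi iz}q^j},$$ $$g_3(\tau,z)=\sum_{j\in\mathbb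 Z}\frac{e^{2\pi ijz}q^{\frac12(j^2-\frac14)}}{1-e^{2\pi iz}q^{j+\frac12}},\quad g_4(\tau,z)=\sum_{j\in\mathbb Z}(-1)^j\frac{e^{2\pi ijz}q^{\frac12(j^2-\frac14)}}{1+e^{2\pi iz}q^{j+\frac12}},$$ $$h_1(\tau,z)=\sum_{j\in\mathbb Z}(-1)^j\frac{e^{2\pi ijz}q^{\frac12j^2}}{1-e^{2\pi iz}q^j},\quad h_2(\tau,z)=\sum_{j\in\mathbb Z}(-1)^j\frac{e^{2\pi i(j+\frac12)z}q^{\frac12(j+\frac12)^2}}{1-e^{2\pi iz}q^{j+\frac12}},$$ $$h_3(\tau,z)=\sum_{j\in\mathbb Z}\frac{e^{2\pi ijz}q^{\frac12j^2}}{1+e^{2\pi iz}q^j},\quad h_4(\tau,z)=\sum_{j\in\mathbb Z}\frac{e^{2\pi i(j+\frac12)z}q^{\frac12(j+\frac12)^2}}{1+e^{2\pi iz}q^{j+\frac12}}.$$ Let $\tau\downarrow0$ mean $\tau=iT$ with $T>0$, $T\to0$. For a constant $C\in\mathbb C$, write $F\sim C\varphi$ if $F/\varphi\to C$ as $\tau\downarrow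 0$; for $C\neq0$ this is the usual asymptotic equivalence $F/(C\varphi)\to1$, and for $C=0$ it says $F=o(\varphi)$. Let $a\in\mathbb C$. Then, with $\varphi$ a power of $-i\tau$, times $e^{-\frac{\pi i}{4\tau}}$ where this factor appears, and $C$ the remaining factor: 1) if $a\notin\mathbb Z$, then $f_1(\tau,a\tau)\sim\frac12\cot(a\pi)\,(-i\tau)^{-1}$, $g_1(\tau,a\tau)\sim\frac12\cot(a\pi)\,(-i\tau)^{-1}$, $h_1(\tau,a\tau)\sim\frac1{2\sin(a\pi)}(-i\tau)^{-1}$; 2) if $a\notin\frac12+\mathbb Z$, then $f_4(\tau,a\tau)\sim-\frac12\tan(a\pi)\,(-i\tau)^{-1}$, $g_3(\tau,a\tau)\sim-\frac12\tan(a\pi)\,(-i\tau)^{-1}$, $h_2(\tau,a\tau)\sim\frac1{2\cos(a\pi)}(-i\tau)^{-1}$; 3) for every $a\in\mathbb C$, $f_2(\tau,a\tau)\sim\cos(a\pi)\,(-i\tau)^{-1}e^{-\frac{\pi i}{4\tau}}$, $f_3(\tau,a\tau)\sim\sin(a\pi)\,(-i\tau)^{-1}e^{-\frac{\pi i}{4\tau}}$,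 $g_2(\tau,a\tau)\sim-\cos(a\pi)\,(-i\tau)^{-1}e^{-\frac{\pi i}{4\tau}}$, $g_4(\tau,a\tau)\sim\sin(a\pi)\,(-i\tau)^{-1}e^{-\frac{\pi i}{4\tau}}$, $h_3(\tau,a\tau)\sim\frac12(-i\tau)^{-\frac12}$, $h_4(\tau,a\tau)\sim\frac12(-i\tau)^{-\frac12}$. -/

import Mathlib

noncomputable section

namespace Appell

open Complex Filter Topology Asymptotics

/-- `q ^ x` for `q = exp (2 π i τ)`, i.e. `exp (2 π i τ x)`. -/
def qPow (τ x : ℂ) : ℂ := exp (2 * Real.pi * I * τ * x)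

/-- `exp (2 π i x)`. -/
def e (x : ℂ) : ℂ := exp (2 * Real.pi * I * x)

def f₁ (τ z : ℂ) : ℂ :=
  ∑' j : ℤ, e (j * z) * qPow τ (1 / 2 * (j : ℂ) ^ 2) / (1 - e z * qPow τ j)

def f₂ (τ z : ℂ) : ℂ :=
  ∑' j : ℤ, (-1 : ℂ) ^ j * (e ((j + 1 / 2) * z) * qPow τ (1 / 2 * ((j : ℂ) + 1 / 2) ^ 2) /
    (1 + e z * qPow τ (j + 1 / 2)))

def f₃ (τ z : ℂ) : ℂ :=
  ∑' j : ℤ, (-1 : ℂ) ^ j * (e (j * z) * qPow τ (1 / 2 * (j : ℂ) ^ 2) / (1 + e z * qPow τ j))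

def f₄ (τ z : ℂ) : ℂ :=
  ∑' j : ℤ, e ((j + 1 / 2) * z) * qPow τ (1 / 2 * ((j : ℂ) + 1 / 2) ^ 2) /
    (1 - e z * qPow τ (j + 1 / 2))

def g₁ (τ z : ℂ) : ℂ :=
  ∑' j : ℤ, e ((j - 1 / 2) * z) * qPow τ (1 / 2 * j * (j - 1)) / (1 - e z * qPow τ j)

def g₂ (τ z : ℂ) : ℂ :=
  ∑' j : ℤ, (-1 : ℂ) ^ j *
    (e ((j - 1 / 2) * z) * qPow τ (1 / 2 * j * (j - 1)) / (1 + e z * qPow τ j))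

def g₃ (τ z : ℂ) : ℂ :=
  ∑' j : ℤ, e (j * z) * qPow τ (1 / 2 * ((j : ℂ) ^ 2 - 1 / 4)) /
    (1 - e z * qPow τ (j + 1 / 2))

def g₄ (τ z : ℂ) : ℂ :=
  ∑' j : ℤ, (-1 : ℂ) ^ j * (e (j * z) * qPow τ (1 / 2 * ((j : ℂ) ^ 2 - 1 / 4)) /
    (1 + e z * qPow τ (j + 1 / 2)))

def h₁ (τ z : ℂ) : ℂ :=
  ∑' j : ℤ, (-1 : ℂ) ^ j * (e (j * z) * qPow τ (1 / 2 * (j : ℂ) ^ 2) / (1 - e z * qPow τ j))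

def h₂ (τ z : ℂ) : ℂ :=
  ∑' j : ℤ, (-1 : ℂ) ^ j * (e ((j + 1 / 2) * z) * qPow τ (1 / 2 * ((j : ℂ) + 1 / 2) ^ 2) /
    (1 - e z * qPow τ (j + 1 / 2)))

def h₃ (τ z : ℂ) : ℂ :=
  ∑' j : ℤ, e (j * z) * qPow τ (1 / 2 * (j : ℂ) ^ 2) / (1 + e z * qPow τ j)

def h₄ (τ z : ℂ) : ℂ :=
  ∑' j : ℤ, e ((j + 1 / 2) * z) * qPow τ (1 / 2 * ((j : ℂ) + 1 / 2) ^ 2) /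
    (1 + e z * qPow τ (j + 1 / 2))

/-- The filter `τ ↓ 0`: `τ = i T` with `T > 0` real and `T → 0`. -/
def downZero : Filter ℂ := map (fun T : ℝ => I * (T : ℂ)) (𝓝[>] 0)

/-- `F(τ) ∼ C φ(τ)` as `τ ↓ 0`, with a constant `C`: the quotient `F / φ` tends to `C`,
and, if `C ≠ 0`, the functions `F` and `C φ` are asymptotically equivalent. For `C = 0`
only the first assertion (`F` is of smaller order than `φ`) is meaningful. -/
def LeadingAsymptotics (F : ℂ → ℂ) (C : ℂ) (φ : ℂ → ℂ) : Prop :=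
  Tendsto (fun τ => F τ / φ τ) downZero (𝓝 C) ∧
    (C ≠ 0 → F ~[downZero] fun τ => C * φ τ)

end Appell

end

/-! ## Leading asymptotics of Appell-type sums as `τ ↓ 0` -/

noncomputable section

namespace Appell

open Complex Filter Topology Asymptotics MeasureTheory
open scoped FourierTransform

/-! ### Gaussian sums over the integers -/

/-! Put `τ = iT`, `z = aτ` and `w = πT(j + a)`. Then `e^{2πiz} q^j = e^{-2w}`, so the denominators
become `2 sinh w` or `2 cosh w` up to a factor `e^{-w}`, and the numerators become the Gaussian
coefficients `coeff T a j`. Shifting the index by `1/2` amounts to replacing `a` by `a + 1/2`, up to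
a factor tending to `1`; this reduces the twelve functions to `f₁`, `g₁`, `h₁`, `f₃`, `g₂`, `h₃`.

Denominator `sinh`: replace `e^{mw} / (2 sinh w)` by its polar part `1 / (2w)`. The error is a
Gaussian sum of size `O(T^{-1/2})`, negligible against `T⁻¹`. What remains is `∑ coeff T a j / (j +
a)`, which tends to `π cot(πa)` by the partial fraction expansion of the cotangent
(`tendsto_tsum_coeff_mul_inv_add`). The alternating sum is twice its even part minus the whole,
which gives `π / sin(πa)`.

Denominator `cosh`, no sign: `e^w / (2 cosh w) = 1/2 + tanh(w)/2`. The `tanh` part is of lower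
order, and the theta series `∑ coeff T a j` is asymptotic to `T^{-1/2}`.

Denominator `cosh` with the sign `(-1)^j`: the sums are exponentially small, so termwise estimates
are useless and Poisson summation is needed. The alternating theta part is `O(T^{-1/2}
e^{-π/(4T)})`, smaller than the main term by a factor `√T`. The parts with kernel `tanh` or `1 /
cosh` have Mordell integrals at `ξ = 1/2 - n`, `t = 1/T`, as dual terms. Moving the contour by `i`
across the pole `i/2` relates `ξ` to `ξ - 1` (`mordell_sub_mordell`); with the parity in `ξ` this
evaluates the integral exactly at `ξ = ±1/2` (`mordell_half`) and bounds it at all other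
half-integers (`norm_mordell_le`). The terms `n = 0, 1` yield the sine or cosine
(`tendsto_mul_tsum_kernel`). -/

lemma summable_exp_neg_mul_sq {δ : ℝ} (hδ : 0 < δ) :
    Summable fun j : ℤ => Real.exp (-δ * (j : ℝ) ^ 2) := by
  have h := (isLittleO_exp_neg_mul_sq_cocompact (a := (δ : ℂ)) (by simpa using hδ) (-2)).isBigO
  have h2 := summable_of_isBigO (Real.summable_abs_int_rpow one_lt_two)
    (h.comp_tendsto Int.tendsto_coe_cofinite)
  refine h2.norm.congr fun j => ?_
  simp [Complex.norm_exp, ← ofReal_pow, ← ofReal_mul, -ofReal_intCast]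

/-- Completing the square: half of the Gaussian exponent absorbs the linear term. -/
lemma neg_sq_add_abs_le {δ : ℝ} (hδ : 0 < δ) (K x : ℝ) :
    -δ * x ^ 2 + K * |x| ≤ -(δ / 2) * x ^ 2 + K ^ 2 / (2 * δ) := by
  have h : K ^ 2 / (2 * δ) = K * |x| - δ / 2 * x ^ 2 + (δ * |x| - K) ^ 2 / (2 * δ) := by
    field_simp
    rw [sub_sq, mul_pow, sq_abs]; ring
  have : 0 ≤ (δ * |x| - K) ^ 2 / (2 * δ) := by positivity
  linarith

lemma summable_exp_neg_sq_add_abs {δ : ℝ} (hδ : 0 < δ) (K : ℝ) :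
    Summable fun j : ℤ => Real.exp (-δ * (j : ℝ) ^ 2 + K * |(j : ℝ)|) := by
  refine Summable.of_nonneg_of_le (fun _ => (Real.exp_pos _).le) (fun j => ?_)
    ((summable_exp_neg_mul_sq (half_pos hδ)).mul_right (Real.exp (K ^ 2 / (2 * δ))))
  rw [← Real.exp_add]
  exact Real.exp_le_exp.2 (neg_sq_add_abs_le hδ K j)

lemma summable_exp_neg_mul_sq_add_abs {δ T : ℝ} (hδ : 0 < δ) (hT : 0 < T) (K : ℝ) :
    Summable fun j : ℤ => Real.exp (T * (-δ * (j : ℝ) ^ 2 + K * |(j : ℝ)|)) := by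
  refine (summable_exp_neg_sq_add_abs (mul_pos hδ hT) (K * T)).congr fun j => ?_
  ring_nf

/-- The theta transformation produces the factor `1 / √T`; the dual series increases with `T`, so
its value at `T = 1` serves as the constant. -/
lemma exists_tsum_exp_neg_sq_le {δ : ℝ} (hδ : 0 < δ) :
    ∃ C, 0 ≤ C ∧ ∀ T, 0 < T → T ≤ 1 →
      ∑' j : ℤ, Real.exp (-(δ * T) * (j : ℝ) ^ 2) ≤ C / √T := by
  refine ⟨1 / √(δ / Real.pi) * ∑' j : ℤ, Real.exp (-(Real.pi ^ 2 / δ) * (j : ℝ) ^ 2), by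
    have : 0 ≤ ∑' j : ℤ, Real.exp (-(Real.pi ^ 2 / δ) * (j : ℝ) ^ 2) :=
      tsum_nonneg fun _ => (Real.exp_pos _).le
    positivity, fun T hT hT1 => ?_⟩
  have hpi := Real.pi_pos
  have h := Real.tsum_exp_neg_mul_int_sq (a := δ * T / Real.pi) (by positivity)
  have e1 : ∀ j : ℤ, -Real.pi * (δ * T / Real.pi) * (j : ℝ) ^ 2 = -(δ * T) * (j : ℝ) ^ 2 := by
    intro j; field_simp
  simp_rw [e1] at h
  rw [h, ← Real.sqrt_eq_rpow, mul_div_right_comm, Real.sqrt_mul (by positivity), ← div_div,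
    div_mul_eq_mul_div]
  refine div_le_div_of_nonneg_right (mul_le_mul_of_nonneg_left ?_ (by positivity))
    (Real.sqrt_nonneg _)
  refine Summable.tsum_le_tsum (fun j => Real.exp_le_exp.2 ?_) ?_
    (summable_exp_neg_mul_sq (by positivity))
  · apply mul_le_mul_of_nonneg_right _ (sq_nonneg _)
    have : Real.pi / (δ / Real.pi * T) = Real.pi ^ 2 / δ / T := by field_simp
    rw [neg_div, neg_le_neg_iff, this]
    exact le_div_self (by positivity) hT hT1
  · have := summable_exp_neg_mul_sq (δ := Real.pi / (δ / Real.pi * T)) (by positivity)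
    simpa only [neg_div] using this

lemma exists_tsum_exp_le {δ : ℝ} (hδ : 0 < δ) (K : ℝ) :
    ∃ C, 0 ≤ C ∧ ∀ T, 0 < T → T ≤ 1 →
      ∑' j : ℤ, Real.exp (T * (-δ * (j : ℝ) ^ 2 + K * |(j : ℝ)|)) ≤ C / √T := by
  obtain ⟨C, hC, h⟩ := exists_tsum_exp_neg_sq_le (half_pos hδ)
  refine ⟨C * Real.exp (K ^ 2 / (2 * δ)), by positivity, fun T hT hT1 => ?_⟩
  rw [mul_div_right_comm]
  refine le_trans ?_ (mul_le_mul_of_nonneg_right (h T hT hT1) (Real.exp_pos _).le)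
  rw [← tsum_mul_right]
  refine Summable.tsum_le_tsum (fun j => ?_) (summable_exp_neg_mul_sq_add_abs hδ hT K)
    ((summable_exp_neg_mul_sq (by positivity)).mul_right _)
  rw [← Real.exp_add]
  refine Real.exp_le_exp.2 ?_
  have h1 := mul_le_mul_of_nonneg_left (neg_sq_add_abs_le hδ K j) hT.le
  have h2 : T * (K ^ 2 / (2 * δ)) ≤ K ^ 2 / (2 * δ) := mul_le_of_le_one_left (by positivity) hT1
  nlinarith

/-! ### The Gaussian coefficients -/

/-- The numerator `e^{2πijz} q^{j²/2}` at `τ = iT`, `z = aτ`. -/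
def coeff (T : ℝ) (a : ℂ) (j : ℤ) : ℂ := exp (-Real.pi * T * ((j : ℂ) ^ 2 + 2 * j * a))

lemma norm_coeff (T : ℝ) (a : ℂ) (j : ℤ) :
    ‖coeff T a j‖ = Real.exp (T * (-Real.pi * (j : ℝ) ^ 2 - 2 * Real.pi * a.re * j)) := by
  rw [coeff, Complex.norm_exp]
  congr 1
  have : (-Real.pi * T * ((j : ℂ) ^ 2 + 2 * j * a)) =
      ((-Real.pi * T * (j : ℝ) ^ 2 : ℝ) : ℂ) + ((-Real.pi * T * 2 * j : ℝ) : ℂ) * a := by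
    push_cast; ring
  rw [this, add_re, ofReal_re, re_ofReal_mul]; ring

lemma norm_coeff_le {T : ℝ} (hT : 0 < T) (a : ℂ) (j : ℤ) :
    ‖coeff T a j‖ ≤
      Real.exp (T * (-Real.pi * (j : ℝ) ^ 2 + 2 * Real.pi * ‖a‖ * |(j : ℝ)|)) := by
  rw [norm_coeff]
  refine Real.exp_le_exp.2 (mul_le_mul_of_nonneg_left ?_ hT.le)
  have h1 : -(a.re * j) ≤ ‖a‖ * |(j : ℝ)| := by
    refine (neg_le_abs _).trans ?_
    rw [abs_mul]
    exact mul_le_mul_of_nonneg_right (abs_re_le_norm a) (abs_nonneg _)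
  nlinarith [Real.pi_pos, mul_le_mul_of_nonneg_left h1 Real.pi_pos.le]

lemma tendsto_coeff (a : ℂ) (j : ℤ) : Tendsto (fun T : ℝ => coeff T a j) (𝓝[>] 0) (𝓝 1) := by
  have : Continuous fun T : ℝ => coeff T a j := by unfold coeff; fun_prop
  have h := (this.tendsto 0).mono_left (nhdsWithin_le_nhds (s := Set.Ioi 0))
  simpa [coeff] using h

/-- A family of terms dominated by `s T` times Gaussian terms has sum `O(s T / √T)`. -/
lemma tendsto_tsum_zero_of_gaussian_bound {F : ℝ → ℤ → ℂ} {δ K B : ℝ} (hδ : 0 < δ) {s : ℝ → ℝ}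
    (hs0 : ∀ T, 0 < T → 0 ≤ s T)
    (hs : Tendsto (fun T => s T / √T) (𝓝[>] 0) (𝓝 0))
    (hF : ∀ᶠ T in 𝓝[>] (0 : ℝ), ∀ j : ℤ,
      ‖F T j‖ ≤ B * s T * Real.exp (T * (-δ * (j : ℝ) ^ 2 + K * |(j : ℝ)|))) :
    Tendsto (fun T => ∑' j, F T j) (𝓝[>] 0) (𝓝 0) := by
  obtain ⟨C, hC, h⟩ := exists_tsum_exp_le hδ K
  refine squeeze_zero_norm' (a := fun T => |B| * C * (s T / √T)) ?_ (by simpa using hs.const_mul _)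
  filter_upwards [hF, self_mem_nhdsWithin,
    mem_nhdsWithin_of_mem_nhds (Iic_mem_nhds (zero_lt_one' ℝ))] with T h1 h2 h3
  have h4 := (summable_exp_neg_mul_sq_add_abs hδ h2 K).mul_left (B * s T)
  refine (tsum_of_norm_bounded h4.hasSum h1).trans ?_
  rw [tsum_mul_left]
  calc _ ≤ |B| * s T * (C / √T) := by
        refine mul_le_mul ?_ (h T h2 h3) (tsum_nonneg fun _ => (Real.exp_pos _).le) ?_
        · exact mul_le_mul_of_nonneg_right (le_abs_self B) (hs0 T h2)
        · exact mul_nonneg (abs_nonneg B) (hs0 T h2)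
    _ = _ := by ring

lemma tendsto_self_div_sqrt : Tendsto (fun T : ℝ => T / √T) (𝓝[>] 0) (𝓝 0) := by
  have : Tendsto (fun T : ℝ => √T) (𝓝[>] 0) (𝓝 0) := by
    simpa using (Real.continuous_sqrt.tendsto 0).mono_left nhdsWithin_le_nhds
  simpa using this

lemma summable_coeff_mul {T : ℝ} (hT : 0 < T) (a : ℂ) {G : ℤ → ℂ} {B K : ℝ}
    (hG : ∀ j : ℤ, ‖G j‖ ≤ B * Real.exp (K * |(j : ℝ)|)) :
    Summable fun j => coeff T a j * G j := by
  refine Summable.of_norm_bounded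
    ((summable_exp_neg_sq_add_abs (δ := T * Real.pi) (by have := Real.pi_pos; positivity)
      (K + T * (2 * Real.pi * ‖a‖))).mul_left B) fun j => ?_
  rw [norm_mul]
  refine (mul_le_mul (norm_coeff_le hT a j) (hG j) (norm_nonneg _) (Real.exp_pos _).le).trans ?_
  rw [mul_left_comm, ← Real.exp_add]
  apply le_of_eq
  ring_nf

/-! ### Hyperbolic functions on a horizontal strip -/

/-- Reverse triangle inequality. This and the next lemma bound denominators from below away from the
imaginary axis, uniformly in `Im w`. -/
lemma abs_sinh_re_le_norm_sinh (w : ℂ) : |Real.sinh w.re| ≤ ‖sinh w‖ := by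
  have h1 := abs_norm_sub_norm_le (exp w) (exp (-w))
  rw [Complex.norm_exp, Complex.norm_exp, neg_re] at h1
  rw [Real.sinh_eq, Complex.sinh, norm_div, abs_div]
  simpa using div_le_div_of_nonneg_right h1 zero_le_two

lemma abs_sinh_re_le_norm_cosh (w : ℂ) : |Real.sinh w.re| ≤ ‖cosh w‖ := by
  have h1 := abs_norm_sub_norm_le (exp w) (-exp (-w))
  rw [norm_neg, Complex.norm_exp, Complex.norm_exp, neg_re, sub_neg_eq_add] at h1
  rw [Real.sinh_eq, Complex.cosh, norm_div, abs_div]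
  simpa using div_le_div_of_nonneg_right h1 zero_le_two

lemma norm_sinh_le_cosh_re (w : ℂ) : ‖sinh w‖ ≤ Real.cosh w.re := by
  have h1 := norm_sub_le (exp w) (exp (-w))
  rw [Complex.norm_exp, Complex.norm_exp, neg_re] at h1
  rw [Real.cosh_eq, Complex.sinh, norm_div]
  simpa using div_le_div_of_nonneg_right h1 zero_le_two

lemma one_le_abs_sinh {x : ℝ} (hx : 1 ≤ |x|) : 1 ≤ |Real.sinh x| := by
  rw [Real.abs_sinh]
  exact hx.trans (Real.self_le_sinh_iff.2 (abs_nonneg x))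

lemma cosh_le_two_mul_abs_sinh {x : ℝ} (hx : 1 ≤ |x|) : Real.cosh x ≤ 2 * |Real.sinh x| := by
  have h1 := one_le_abs_sinh hx
  have h2 := Real.cosh_sq x
  rw [← sq_abs (Real.sinh x)] at h2
  nlinarith [Real.cosh_pos x]

lemma sinh_ne_zero_of_abs_im_lt {w : ℂ} (h0 : w ≠ 0) (hw : |w.im| < Real.pi) : sinh w ≠ 0 := by
  intro h
  have h1 : sin (w * I) = 0 := by rw [Complex.sin_mul_I, h, zero_mul]
  obtain ⟨k, hk⟩ := Complex.sin_eq_zero_iff.1 h1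
  have hw' : w = -(k * Real.pi) * I := by
    rw [← mul_one w, ← neg_neg (1 : ℂ), ← I_mul_I, mul_neg, ← mul_assoc, hk]; ring
  have him : w.im = -(k * Real.pi) := by rw [hw']; simp
  rw [him, abs_neg, abs_mul, abs_of_pos Real.pi_pos] at hw
  have hk1 : |(k : ℝ)| < 1 := by
    by_contra hcon
    exact absurd hw (not_lt.2 (le_mul_of_one_le_left Real.pi_pos.le (not_lt.1 hcon)))
  have hk0 : k = 0 := by
    rw [← Int.cast_abs] at hk1
    exact Int.abs_lt_one_iff.1 (by exact_mod_cast hk1)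
  apply h0
  rw [hw', hk0]; simp

lemma cosh_ne_zero_of_abs_im_lt {w : ℂ} (hw : |w.im| < Real.pi / 2) : cosh w ≠ 0 := by
  intro h
  have h1 : sinh (2 * w) = 0 := by rw [Complex.sinh_two_mul, h, mul_zero]
  by_cases h0 : w = 0
  · simp [h0] at h
  · refine sinh_ne_zero_of_abs_im_lt (mul_ne_zero two_ne_zero h0) ?_ h1
    have : (2 * w).im = 2 * w.im := by simp
    rw [this, abs_mul, abs_two]
    linarith

lemma isOpen_strip (r : ℝ) : IsOpen {w : ℂ | |w.im| < r} :=
  isOpen_lt (continuous_abs.comp continuous_im) continuous_const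

lemma exists_bound_on_square {F : ℂ → ℂ} {r : ℝ} (hr : 1 < r)
    (hF : ContinuousOn F {w : ℂ | |w.im| < r}) :
    ∃ K, 0 ≤ K ∧ ∀ w : ℂ, |w.re| ≤ 1 → |w.im| ≤ 1 → ‖F w‖ ≤ K := by
  have hc : IsCompact (Set.Icc (-1 : ℝ) 1 ×ℂ Set.Icc (-1 : ℝ) 1) :=
    isCompact_Icc.reProdIm isCompact_Icc
  obtain ⟨K, hK⟩ := hc.exists_bound_of_continuousOn (hF.mono fun w hw =>
    (abs_le.2 hw.2).trans_lt hr)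
  exact ⟨|K|, abs_nonneg _, fun w h1 h2 =>
    (hK w ⟨abs_le.1 h1, abs_le.1 h2⟩).trans (le_abs_self K)⟩

/-- The function `e^{mw} / (2 sinh w)` differs from its polar part `1 / (2w)` by
`O(e^{m |Re w|})`. -/
lemma exists_bound_exp_div_sinh (m : ℕ) :
    ∃ K, 0 ≤ K ∧ ∀ w : ℂ, w ≠ 0 → |w.im| ≤ 1 →
      ‖exp (m * w) / (2 * sinh w) - 1 / (2 * w)‖ ≤ K * Real.exp (m * |w.re|) := by
  set U : Set ℂ := {w : ℂ | |w.im| < Real.pi} with hU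
  have hU0 : U ∈ 𝓝 (0 : ℂ) := (isOpen_strip _).mem_nhds (by simp [Real.pi_pos])
  -- `D` is `sinh w / w` with the singularity removed, so `G` below is `w` times `e^{mw} / (2 sinh
  -- w)`, and the slope of `G` at `0` is exactly the difference to be bounded.
  set D : ℂ → ℂ := dslope sinh 0 with hD
  have hDd : DifferentiableOn ℂ D U :=
    (differentiableOn_dslope hU0).2 Complex.differentiable_sinh.differentiableOn
  have hD0 : D 0 = 1 := by simp [hD]
  have hDw : ∀ w, w ≠ 0 → D w = sinh w / w := fun w hw => by
    rw [hD, dslope_of_ne _ hw, slope_def_field]; simp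
  have hDne : ∀ w ∈ U, D w ≠ 0 := fun w hw => by
    by_cases h : w = 0
    · rw [h, hD0]; exact one_ne_zero
    · rw [hDw w h]; exact div_ne_zero (sinh_ne_zero_of_abs_im_lt h hw) h
  set G : ℂ → ℂ := fun w => exp (m * w) / (2 * D w) with hG
  have hGd : DifferentiableOn ℂ G U := by
    refine DifferentiableOn.div (by fun_prop) (hDd.const_mul 2) fun w hw => ?_
    exact mul_ne_zero two_ne_zero (hDne w hw)
  have hcont : ContinuousOn (dslope G 0) U :=
    ((differentiableOn_dslope hU0).2 hGd).continuousOn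
  obtain ⟨K, hK, hb⟩ := exists_bound_on_square (by linarith [Real.pi_gt_three]) hcont
  refine ⟨K + 1, by positivity, fun w h0 him => ?_⟩
  have hexp : 1 ≤ Real.exp (m * |w.re|) := Real.one_le_exp (by positivity)
  rcases le_total |w.re| 1 with h | h
  · have h1 := hb w h him
    rw [dslope_of_ne _ h0, slope_def_field, sub_zero, hG] at h1
    simp only [hD0, mul_zero, exp_zero, hDw w h0] at h1
    have e1 : (exp (m * w) / (2 * (sinh w / w)) - 1 / (2 * 1)) / w =
        exp (m * w) / (2 * sinh w) - 1 / (2 * w) := by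
      have := sinh_ne_zero_of_abs_im_lt h0 (him.trans_lt (by linarith [Real.pi_gt_three]))
      field_simp
    rw [e1] at h1
    nlinarith
  · have hs : 1 ≤ ‖sinh w‖ := (one_le_abs_sinh h).trans (abs_sinh_re_le_norm_sinh w)
    have hw : 1 ≤ ‖w‖ := h.trans (abs_re_le_norm w)
    have h1 : ‖exp (m * w) / (2 * sinh w)‖ ≤ Real.exp (m * |w.re|) / 2 := by
      rw [norm_div, norm_mul, Complex.norm_exp, Complex.norm_two]
      refine div_le_div₀ (Real.exp_pos _).le (Real.exp_le_exp.2 ?_) two_pos (by linarith)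
      have : ((m : ℂ) * w).re = m * w.re := by simp
      rw [this]
      exact mul_le_mul_of_nonneg_left (le_abs_self _) (Nat.cast_nonneg m)
    have h2 : ‖1 / (2 * w)‖ ≤ 1 / 2 := by
      rw [norm_div, norm_mul, norm_one, Complex.norm_two]
      exact one_div_le_one_div_of_le two_pos (by linarith)
    have := norm_sub_le (exp (m * w) / (2 * sinh w)) (1 / (2 * w))
    nlinarith

/-- On the strip `|Im w| ≤ 1` one has `tanh w = O(w)`. -/
lemma exists_bound_tanh :
    ∃ K, 0 ≤ K ∧ ∀ w : ℂ, |w.im| ≤ 1 → ‖sinh w / cosh w‖ ≤ K * ‖w‖ := by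
  set U : Set ℂ := {w : ℂ | |w.im| < Real.pi / 2} with hU
  have hU0 : U ∈ 𝓝 (0 : ℂ) := (isOpen_strip _).mem_nhds (by simp [Real.pi_pos])
  have hd : DifferentiableOn ℂ (fun w => sinh w / cosh w) U :=
    Complex.differentiable_sinh.differentiableOn.div Complex.differentiable_cosh.differentiableOn
      fun w hw => cosh_ne_zero_of_abs_im_lt hw
  obtain ⟨K, hK, hb⟩ := exists_bound_on_square (by linarith [Real.pi_gt_three])
    ((differentiableOn_dslope hU0).2 hd).continuousOn
  refine ⟨K + 2, by positivity, fun w him => ?_⟩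
  by_cases h0 : w = 0
  · simp [h0]
  rcases le_total |w.re| 1 with h | h
  · have h1 := hb w h him
    rw [dslope_of_ne _ h0, slope_def_field, sub_zero, sinh_zero, zero_div, sub_zero, norm_div,
      div_le_iff₀ (norm_pos_iff.2 h0)] at h1
    nlinarith [norm_nonneg w]
  · have hs := one_le_abs_sinh h
    have hw : 1 ≤ ‖w‖ := h.trans (abs_re_le_norm w)
    have h1 : ‖sinh w / cosh w‖ ≤ 2 := by
      have h3 := abs_sinh_re_le_norm_cosh w
      rw [norm_div, div_le_iff₀ (by linarith)]
      have := norm_sinh_le_cosh_re w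
      have := cosh_le_two_mul_abs_sinh h
      linarith
    nlinarith

/-! ### Sums with a simple pole -/

lemma mem_integerComplement_of_sin_ne_zero {a : ℂ} (ha : sin (a * Real.pi) ≠ 0) :
    a ∈ integerComplement := by
  rintro ⟨n, rfl⟩
  exact ha (Complex.sin_int_mul_pi n)

/-- The difference is `-a / (j(j + a))` except at `j = 0` and `j = -a`, where the inverse of zero is
`0`; these finitely many terms do not affect summability. -/
lemma summable_inv_add_sub_inv (a : ℂ) :
    Summable fun j : ℤ => ((j : ℂ) + a)⁻¹ - (j : ℂ)⁻¹ := by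
  have h : Summable fun j : ℤ => ((j : ℂ) * (j + a))⁻¹ := by
    apply EisensteinSeries.summable_inv_of_isBigO_rpow_inv (a := 2) (by norm_num)
    have := (EisensteinSeries.linear_inv_isBigO_right 0 a).mul
      (EisensteinSeries.linear_inv_isBigO_right 1 a)
    simpa [pow_two, add_comm, mul_comm] using this
  refine (h.mul_left (-a)).congr_cofinite ?_
  have h1 : ∀ᶠ j : ℤ in cofinite, j ≠ 0 := (Set.finite_singleton (0 : ℤ)).compl_mem_cofinite
  have h2 : ∀ᶠ j : ℤ in cofinite, (j : ℂ) + a ≠ 0 := by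
    refine Set.Finite.compl_mem_cofinite (s := {j : ℤ | (j : ℂ) + a = 0})
      (Set.Subsingleton.finite fun i hi j hj => ?_)
    have : (i : ℂ) = j := add_right_cancel (hi.trans (Eq.symm hj))
    exact_mod_cast this
  filter_upwards [h1, h2] with j h1 h2
  have h1' : (j : ℂ) ≠ 0 := by exact_mod_cast h1
  field_simp
  ring

/-- Pairing `j` with `-j` cancels the terms `1/j` and leaves the cotangent series; `j = 0`
contributes `1/a` because `0⁻¹ = 0`. -/
lemma tsum_inv_add_sub_inv {a : ℂ} (ha : a ∈ integerComplement) :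
    ∑' j : ℤ, (((j : ℂ) + a)⁻¹ - (j : ℂ)⁻¹) = Real.pi * cot (Real.pi * a) := by
  have hs := summable_inv_add_sub_inv a
  have h1 : Summable fun n : ℕ => ((((n + 1 : ℕ) : ℤ) : ℂ) + a)⁻¹ - (((n + 1 : ℕ) : ℤ) : ℂ)⁻¹ :=
    hs.comp_injective (i := fun n : ℕ => ((n + 1 : ℕ) : ℤ)) fun m n h => by simpa using h
  have h2 : Summable fun n : ℕ => (((-(n + 1) : ℤ) : ℂ) + a)⁻¹ - ((-(n + 1) : ℤ) : ℂ)⁻¹ :=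
    hs.comp_injective (i := fun n : ℕ => -((n : ℤ) + 1)) fun m n h => by simpa using h
  have h3 := tsum_of_add_one_of_neg_add_one
    (f := fun j : ℤ => ((j : ℂ) + a)⁻¹ - (j : ℂ)⁻¹) (by simpa using h1) (by simpa using h2)
  rw [h3, add_right_comm, ← Summable.tsum_add (by simpa using h1) (by simpa using h2),
    ← sub_add_cancel ((Real.pi : ℂ) * cot (Real.pi * a)) (1 / a), cot_series_rep' ha]
  simp only [Int.cast_zero, zero_add, inv_zero, sub_zero, one_div]
  congr 1
  refine tsum_congr fun n => ?_
  push_cast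
  rw [show -(n + 1 : ℂ) + a = a - (n + 1) by ring, inv_neg, add_comm (n + 1 : ℂ) a]
  ring

lemma norm_coeff_le_const {T : ℝ} (hT : 0 < T) (hT1 : T ≤ 1) (a : ℂ) (j : ℤ) :
    ‖coeff T a j‖ ≤ Real.exp (Real.pi * ‖a‖ ^ 2) := by
  refine (norm_coeff_le hT a j).trans (Real.exp_le_exp.2 ?_)
  have h1 : -Real.pi * (j : ℝ) ^ 2 + 2 * Real.pi * ‖a‖ * |(j : ℝ)| ≤ Real.pi * ‖a‖ ^ 2 := by
    rw [← sq_abs (j : ℝ)]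
    nlinarith [mul_nonneg Real.pi_pos.le (sq_nonneg (|(j : ℝ)| - ‖a‖))]
  refine (mul_le_mul_of_nonneg_left h1 hT.le).trans (mul_le_of_le_one_left ?_ hT1)
  have := Real.pi_pos
  positivity

lemma norm_exp_sub_exp_neg_le (x : ℂ) : ‖exp (-x) - exp x‖ ≤ 2 * ‖x‖ * Real.exp ‖x‖ := by
  have h : ∀ y : ℂ, ‖exp y - 1‖ ≤ ‖y‖ * Real.exp ‖y‖ := fun y => by
    simpa using norm_exp_sub_sum_le_norm_mul_exp y 1
  have h1 := norm_sub_le (exp (-x) - 1) (exp x - 1)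
  have h2 := h x
  have h3 := h (-x)
  rw [norm_neg] at h3
  rw [sub_sub_sub_cancel_right] at h1
  linarith

lemma norm_int_inv_le_one (j : ℤ) : ‖(j : ℂ)⁻¹‖ ≤ 1 := by
  by_cases h : j = 0
  · simp [h]
  · rw [norm_inv, Complex.norm_intCast]
    refine inv_le_one_of_one_le₀ ?_
    rw [← Int.cast_abs]
    exact_mod_cast Int.one_le_abs h

/-- As `1/j` is odd, only the odd part of `coeff T a` counts. It is `O(T|j|)` times a Gaussian,
which cancels `1/|j|` and leaves a sum of size `O(√T)`. -/
lemma tendsto_tsum_coeff_mul_inv_int (a : ℂ) :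
    Tendsto (fun T : ℝ => ∑' j : ℤ, coeff T a j * (j : ℂ)⁻¹) (𝓝[>] 0) (𝓝 0) := by
  have key : Tendsto (fun T : ℝ => ∑' j : ℤ, (coeff T a j - coeff T a (-j)) * (j : ℂ)⁻¹ / 2)
      (𝓝[>] 0) (𝓝 0) := by
    refine tendsto_tsum_zero_of_gaussian_bound (δ := Real.pi) (K := 2 * Real.pi * ‖a‖)
      (B := 2 * Real.pi * ‖a‖) Real.pi_pos (s := id) (fun T h => h.le) tendsto_self_div_sqrt ?_
    filter_upwards [self_mem_nhdsWithin] with T hT j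
    have hT' : 0 < T := hT
    have hpi := Real.pi_pos
    by_cases hj : j = 0
    · simp only [hj, Int.cast_zero, inv_zero, mul_zero, zero_div, norm_zero]
      positivity
    have hj' : 0 < |(j : ℝ)| := abs_pos.2 (by exact_mod_cast hj)
    have e1 : coeff T a j - coeff T a (-j) = exp ((-Real.pi * T * (j : ℝ) ^ 2 : ℝ)) *
        (exp (-(2 * Real.pi * T * j * a)) - exp (2 * Real.pi * T * j * a)) := by
      rw [mul_sub, ← Complex.exp_add, ← Complex.exp_add, coeff, coeff]
      push_cast
      congr 2 <;> ring
    have e2 : ‖(2 * Real.pi * T * j * a : ℂ)‖ = 2 * Real.pi * ‖a‖ * T * |(j : ℝ)| := by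
      simp only [norm_mul, Complex.norm_two, Complex.norm_real, Complex.norm_intCast,
        Real.norm_eq_abs, abs_of_pos hT', abs_of_pos hpi]
      ring
    have h1 := norm_exp_sub_exp_neg_le (2 * Real.pi * T * j * a)
    rw [e2] at h1
    rw [norm_div, norm_mul, e1, norm_mul, Complex.norm_exp, ofReal_re, norm_inv,
      Complex.norm_intCast, Complex.norm_two, id]
    calc _ ≤ Real.exp (-Real.pi * T * (j : ℝ) ^ 2) * (2 * (2 * Real.pi * ‖a‖ * T * |(j : ℝ)|) *
          Real.exp (2 * Real.pi * ‖a‖ * T * |(j : ℝ)|)) * |(j : ℝ)|⁻¹ / 2 := by gcongr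
      _ = 2 * Real.pi * ‖a‖ * T * (Real.exp (-Real.pi * T * (j : ℝ) ^ 2) *
          Real.exp (2 * Real.pi * ‖a‖ * T * |(j : ℝ)|)) := by field_simp
      _ = _ := by rw [← Real.exp_add]; ring_nf
  refine key.congr' ?_
  filter_upwards [self_mem_nhdsWithin] with T hT
  have hs : Summable fun j : ℤ => coeff T a j * (j : ℂ)⁻¹ :=
    summable_coeff_mul hT a (B := 1) (K := 0) fun j => by simpa using norm_int_inv_le_one j
  have hs' : Summable fun j : ℤ => coeff T a (-j) * (j : ℂ)⁻¹ := by
    refine (((Equiv.neg ℤ).summable_iff.2 hs).neg).congr fun j => ?_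
    simp [inv_neg]
  have e1 : ∑' j : ℤ, coeff T a (-j) * (j : ℂ)⁻¹ = -∑' j : ℤ, coeff T a j * (j : ℂ)⁻¹ := by
    rw [← (Equiv.neg ℤ).tsum_eq (fun j : ℤ => coeff T a j * (j : ℂ)⁻¹), ← tsum_neg]
    refine tsum_congr fun j => ?_
    simp [inv_neg]
  rw [tsum_div_const]
  simp_rw [sub_mul]
  rw [hs.tsum_sub hs', e1]
  ring

lemma exists_norm_inv_add_le (a : ℂ) : ∃ B, ∀ j : ℤ, ‖((j : ℂ) + a)⁻¹‖ ≤ B := by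
  obtain ⟨B, hB⟩ :=
    (summable_inv_add_sub_inv a).norm.tendsto_cofinite_zero.bddAbove_range_of_cofinite
  refine ⟨B + 1, fun j => ?_⟩
  have h1 : ‖((j : ℂ) + a)⁻¹ - (j : ℂ)⁻¹‖ ≤ B := hB ⟨j, rfl⟩
  have h2 := norm_add_le (((j : ℂ) + a)⁻¹ - (j : ℂ)⁻¹) (j : ℂ)⁻¹
  rw [sub_add_cancel] at h2
  linarith [norm_int_inv_le_one j]

lemma summable_coeff_mul_inv_add {T : ℝ} (hT : 0 < T) (a : ℂ) :
    Summable fun j : ℤ => coeff T a j * ((j : ℂ) + a)⁻¹ := by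
  obtain ⟨B, hB⟩ := exists_norm_inv_add_le a
  exact summable_coeff_mul hT a (B := B) (K := 0) (by simpa using hB)

/-- The series without coefficients is not absolutely convergent. Subtracting `1/j` makes dominated
convergence applicable, and the subtracted sum tends to `0` by oddness. -/
lemma tendsto_tsum_coeff_mul_inv_add {a : ℂ} (ha : a ∈ integerComplement) :
    Tendsto (fun T : ℝ => ∑' j : ℤ, coeff T a j * ((j : ℂ) + a)⁻¹) (𝓝[>] 0)
      (𝓝 (Real.pi * cot (Real.pi * a))) := by
  have h1 : Tendsto (fun T : ℝ => ∑' j : ℤ, coeff T a j * (((j : ℂ) + a)⁻¹ - (j : ℂ)⁻¹)) (𝓝[>] 0)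
      (𝓝 (∑' j : ℤ, (((j : ℂ) + a)⁻¹ - (j : ℂ)⁻¹))) := by
    refine tendsto_tsum_of_dominated_convergence
      ((summable_inv_add_sub_inv a).norm.mul_left (Real.exp (Real.pi * ‖a‖ ^ 2))) (fun j => ?_) ?_
    · simpa using (tendsto_coeff a j).mul_const (((j : ℂ) + a)⁻¹ - (j : ℂ)⁻¹)
    · filter_upwards [self_mem_nhdsWithin,
        mem_nhdsWithin_of_mem_nhds (Iic_mem_nhds (zero_lt_one' ℝ))] with T hT hT1 j
      rw [norm_mul]
      exact mul_le_mul_of_nonneg_right (norm_coeff_le_const hT hT1 a j) (norm_nonneg _)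
  have h2 := h1.add (tendsto_tsum_coeff_mul_inv_int a)
  rw [add_zero, tsum_inv_add_sub_inv ha] at h2
  refine h2.congr' ?_
  filter_upwards [self_mem_nhdsWithin] with T hT
  have hs : Summable fun j : ℤ => coeff T a j * (j : ℂ)⁻¹ :=
    summable_coeff_mul hT a (B := 1) (K := 0) fun j => by simpa using norm_int_inv_le_one j
  have hs' := (summable_coeff_mul_inv_add hT a).sub hs
  simp_rw [← mul_sub] at hs'
  rw [← hs'.tsum_add hs]
  refine tsum_congr fun j => ?_
  ring

lemma tsum_neg_one_zpow_mul {f : ℤ → ℂ} (hf : Summable f) :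
    ∑' j : ℤ, (-1 : ℂ) ^ j * f j = 2 * ∑' j : ℤ, f (2 * j) - ∑' j : ℤ, f j := by
  have hinj : Function.Injective fun j : ℤ => 2 * j := fun i j h => by simpa using h
  have h1 : HasSum (Set.indicator (Set.range fun j : ℤ => 2 * j) f) (∑' j : ℤ, f (2 * j)) :=
    hasSum_subtype_iff_indicator.1
      (hinj.hasSum_range_iff.2 (hf.comp_injective hinj).hasSum)
  rw [← ((h1.mul_left 2).sub hf.hasSum).tsum_eq]
  refine tsum_congr fun j => ?_
  rcases Int.even_or_odd' j with ⟨k, rfl | rfl⟩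
  · rw [Set.indicator_of_mem (Set.mem_range_self k), (even_two_mul k).neg_one_zpow]; ring
  · rw [Set.indicator_of_notMem (by rintro ⟨l, hl⟩; simp only at hl; omega),
      (odd_two_mul_add_one k).neg_one_zpow]; ring

/-- Twice the even part is the non-alternating series with `(4T, a/2)` in place of `(T, a)`, and
`cot(πa/2) - cot(πa) = 1 / sin(πa)`. -/
lemma tendsto_tsum_neg_one_zpow_mul_coeff_mul_inv_add {a : ℂ} (ha : sin (a * Real.pi) ≠ 0) :
    Tendsto (fun T : ℝ => ∑' j : ℤ, (-1 : ℂ) ^ j * (coeff T a j * ((j : ℂ) + a)⁻¹)) (𝓝[>] 0)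
      (𝓝 (Real.pi / sin (a * Real.pi))) := by
  have hs2 : sin (a * Real.pi) = 2 * sin (a / 2 * Real.pi) * cos (a / 2 * Real.pi) := by
    rw [← Complex.sin_two_mul]; congr 1; ring
  have hs : sin (a / 2 * Real.pi) ≠ 0 := fun h => ha (by rw [hs2, h]; ring)
  have hc : cos (a / 2 * Real.pi) ≠ 0 := fun h => ha (by rw [hs2, h]; ring)
  have hT4 : Tendsto (fun T : ℝ => 4 * T) (𝓝[>] 0) (𝓝[>] 0) := by
    refine tendsto_nhdsWithin_iff.2 ⟨?_, ?_⟩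
    · have : Continuous fun T : ℝ => 4 * T := by fun_prop
      simpa using (this.tendsto 0).mono_left (nhdsWithin_le_nhds (s := Set.Ioi 0))
    · filter_upwards [self_mem_nhdsWithin] with T (hT : 0 < T)
      exact mul_pos four_pos hT
  have h1 := (tendsto_tsum_coeff_mul_inv_add (mem_integerComplement_of_sin_ne_zero hs)).comp hT4
  have h2 := tendsto_tsum_coeff_mul_inv_add (mem_integerComplement_of_sin_ne_zero ha)
  have e1 : (Real.pi : ℂ) / sin (a * Real.pi) =
      Real.pi * cot (Real.pi * (a / 2)) - Real.pi * cot (Real.pi * a) := by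
    rw [cot_eq_cos_div_sin, cot_eq_cos_div_sin, mul_comm _ (a / 2), mul_comm _ a]
    have h3 : cos (a * Real.pi) = 2 * cos (a / 2 * Real.pi) ^ 2 - 1 := by
      rw [← Complex.cos_two_mul]; congr 1; ring
    rw [hs2, h3]
    field_simp
    ring
  rw [e1]
  refine (h1.sub h2).congr' ?_
  filter_upwards [self_mem_nhdsWithin] with T hT
  rw [tsum_neg_one_zpow_mul (summable_coeff_mul_inv_add hT a), ← tsum_mul_left, Function.comp]
  congr 1
  refine tsum_congr fun j => ?_
  have e2 : coeff (4 * T) (a / 2) j = coeff T a (2 * j) := by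
    rw [coeff, coeff]; push_cast; congr 1; ring
  rw [e2]
  push_cast
  rw [show (2 * (j : ℂ) + a) = 2 * (j + a / 2) by ring, mul_inv]
  ring

lemma eventually_mul_abs_le_one (x : ℝ) : ∀ᶠ T in 𝓝[>] (0 : ℝ), |Real.pi * T * x| ≤ 1 := by
  have : Continuous fun T : ℝ => |Real.pi * T * x| := by fun_prop
  have h := (this.tendsto 0).mono_left (nhdsWithin_le_nhds (s := Set.Ioi 0))
  simp only [mul_zero, zero_mul, abs_zero] at h
  exact (h.eventually (Iio_mem_nhds zero_lt_one)).mono fun T hT => le_of_lt hT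

lemma re_pi_mul (T : ℝ) (j : ℤ) (a : ℂ) :
    ((Real.pi : ℂ) * T * (j + a)).re = Real.pi * T * (j + a.re) := by
  rw [← ofReal_mul, re_ofReal_mul]; simp

lemma im_pi_mul (T : ℝ) (j : ℤ) (a : ℂ) :
    ((Real.pi : ℂ) * T * (j + a)).im = Real.pi * T * a.im := by
  rw [← ofReal_mul, im_ofReal_mul]; simp

lemma abs_re_pi_mul_le {T : ℝ} (hT : 0 < T) (hT1 : T ≤ 1) (j : ℤ) (a : ℂ) :
    |((Real.pi : ℂ) * T * (j + a)).re| ≤ Real.pi * ‖a‖ + T * (Real.pi * |(j : ℝ)|) := by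
  rw [re_pi_mul, abs_mul, abs_of_pos (mul_pos Real.pi_pos hT)]
  have h1 : |(j : ℝ) + a.re| ≤ |(j : ℝ)| + ‖a‖ :=
    (abs_add_le _ _).trans (add_le_add_right (abs_re_le_norm a) _)
  have h2 := mul_le_mul_of_nonneg_left h1 (mul_pos Real.pi_pos hT).le
  have h3 : T * (Real.pi * ‖a‖) ≤ Real.pi * ‖a‖ :=
    mul_le_of_le_one_left (mul_nonneg Real.pi_pos.le (norm_nonneg _)) hT1
  linarith

/-- Reduction of the sums with denominators `sinh` to sums of `1 / (j + a)`. -/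
lemma tendsto_mul_tsum_exp_div_sinh {a : ℂ} (ha : a ∈ integerComplement) (m : ℕ) {ε : ℤ → ℂ}
    (hε : ∀ j, ‖ε j‖ = 1) {l : ℂ}
    (hl : Tendsto (fun T : ℝ => ∑' j : ℤ, ε j * (coeff T a j * ((j : ℂ) + a)⁻¹)) (𝓝[>] 0) (𝓝 l)) :
    Tendsto (fun T : ℝ => (T : ℂ) * ∑' j : ℤ, ε j * (coeff T a j *
        (exp (m * (Real.pi * T * (j + a))) / (2 * sinh (Real.pi * T * (j + a))))))
      (𝓝[>] 0) (𝓝 (l / (2 * Real.pi))) := by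
  obtain ⟨K, hK, hb⟩ := exists_bound_exp_div_sinh m
  have hpi := Real.pi_pos
  have hne : ∀ j : ℤ, (j : ℂ) + a ≠ 0 := fun j => by
    rw [add_comm]; exact integerComplement_add_ne_zero ha j
  have hbound : ∀ᶠ T : ℝ in 𝓝[>] 0, ∀ j : ℤ,
      ‖(T : ℂ) * (ε j * (coeff T a j *
        (exp (m * (Real.pi * T * (j + a))) / (2 * sinh (Real.pi * T * (j + a))) -
          1 / (2 * (Real.pi * T * (j + a))))))‖ ≤
      K * Real.exp (m * (Real.pi * ‖a‖)) * T *
        Real.exp (T * (-Real.pi * (j : ℝ) ^ 2 +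
          (2 * Real.pi * ‖a‖ + m * Real.pi) * |(j : ℝ)|)) := by
    filter_upwards [self_mem_nhdsWithin, eventually_mul_abs_le_one a.im,
      mem_nhdsWithin_of_mem_nhds (Iic_mem_nhds (zero_lt_one' ℝ))] with T hT him hT1 j
    have hT' : (T : ℂ) ≠ 0 := by exact_mod_cast (ne_of_gt hT)
    have hpi' : (Real.pi : ℂ) ≠ 0 := by exact_mod_cast hpi.ne'
    have h1 := hb (Real.pi * T * (j + a)) (mul_ne_zero (mul_ne_zero hpi' hT') (hne j))
      (by rw [im_pi_mul]; exact him)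
    rw [norm_mul, norm_mul, norm_mul, hε, one_mul, Complex.norm_real, Real.norm_eq_abs,
      abs_of_pos hT]
    calc _ ≤ T * (Real.exp (T * (-Real.pi * (j : ℝ) ^ 2 + 2 * Real.pi * ‖a‖ * |(j : ℝ)|)) *
          (K * Real.exp (m * (Real.pi * ‖a‖ + T * (Real.pi * |(j : ℝ)|))))) := by
          refine mul_le_mul_of_nonneg_left (mul_le_mul (norm_coeff_le hT a j) (h1.trans ?_)
            (norm_nonneg _) (Real.exp_pos _).le) (le_of_lt hT)
          gcongr
          exact abs_re_pi_mul_le hT hT1 j a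
      _ = K * T * (Real.exp (T * (-Real.pi * (j : ℝ) ^ 2 + 2 * Real.pi * ‖a‖ * |(j : ℝ)|)) *
          Real.exp (m * (Real.pi * ‖a‖ + T * (Real.pi * |(j : ℝ)|)))) := by ring
      _ = K * T * (Real.exp (m * (Real.pi * ‖a‖)) * Real.exp (T * (-Real.pi * (j : ℝ) ^ 2 +
            (2 * Real.pi * ‖a‖ + m * Real.pi) * |(j : ℝ)|))) := by
          rw [← Real.exp_add, ← Real.exp_add]; ring_nf
      _ = _ := by ring
  -- After multiplication by `T` the error is at most `T · O(T^{-1/2})`, while in the polar part the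
  -- factor `T` cancels against `w = πT(j + a)`.
  have h0 := tendsto_tsum_zero_of_gaussian_bound hpi (s := id) (fun T h => h.le)
    tendsto_self_div_sqrt hbound
  have h1 := h0.add (hl.div_const (2 * (Real.pi : ℂ)))
  rw [zero_add] at h1
  refine h1.congr' ?_
  filter_upwards [self_mem_nhdsWithin, hbound] with T (hT : 0 < T) hbT
  have hT' : (T : ℂ) ≠ 0 := by exact_mod_cast hT.ne'
  have hpi' : (Real.pi : ℂ) ≠ 0 := by exact_mod_cast hpi.ne'
  have hs1 := Summable.of_norm_bounded
    ((summable_exp_neg_mul_sq_add_abs hpi hT (2 * Real.pi * ‖a‖ + m * Real.pi)).mul_left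
      (K * Real.exp (m * (Real.pi * ‖a‖)) * T)) hbT
  have hs2 : Summable fun j : ℤ => ε j * (coeff T a j * ((j : ℂ) + a)⁻¹) :=
    Summable.of_norm_bounded (summable_coeff_mul_inv_add hT a).norm fun j => by
      rw [norm_mul, hε, one_mul]
  replace hs2 := hs2.div_const (2 * (Real.pi : ℂ))
  rw [← tsum_div_const, ← hs1.tsum_add hs2, ← tsum_mul_left]
  refine tsum_congr fun j => ?_
  have := hne j
  rw [show (1 : ℂ) / (2 * (Real.pi * T * (j + a))) = (j + a : ℂ)⁻¹ / (2 * Real.pi) / T by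
    field_simp]
  field_simp
  ring

/-! ### Theta series -/

lemma ofReal_cpow_half {T : ℝ} (hT : 0 < T) : (T : ℂ) ^ (1 / 2 : ℂ) = (√T : ℝ) := by
  rw [Real.sqrt_eq_rpow, ofReal_cpow hT.le]
  norm_num

lemma neg_one_zpow_eq_exp (j : ℤ) : (-1 : ℂ) ^ j = exp (Real.pi * I * j) := by
  rw [← Complex.exp_pi_mul_I, ← Complex.exp_int_mul, mul_comm]

/-- Jacobi's transformation. As `T → 0` only the dual term `n = 0` survives. -/
lemma sqrt_mul_tsum_coeff {T : ℝ} (hT : 0 < T) (a : ℂ) :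
    (√T : ℂ) * ∑' j : ℤ, coeff T a j =
      ∑' n : ℤ, exp (-Real.pi / T * (n : ℂ) ^ 2 +
        (2 * Real.pi * I * a * n + Real.pi * T * a ^ 2)) := by
  have hT' : (T : ℂ) ≠ 0 := by exact_mod_cast hT.ne'
  have hs : ((√T : ℝ) : ℂ) ≠ 0 := by exact_mod_cast (Real.sqrt_pos.2 hT).ne'
  have h := Complex.tsum_exp_neg_quadratic (a := (T : ℂ)) (by simpa using hT) (-T * a)
  rw [ofReal_cpow_half hT] at h
  have e1 : ∀ j : ℤ, coeff T a j =
      exp (-Real.pi * T * (j : ℂ) ^ 2 + 2 * Real.pi * (-T * a) * j) := fun j => by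
    rw [coeff]; congr 1; ring
  simp_rw [e1]
  rw [h, ← mul_assoc, mul_one_div_cancel hs, one_mul]
  refine tsum_congr fun n => ?_
  congr 1
  field_simp
  linear_combination -((T : ℂ) ^ 2 * a ^ 2) * I_sq

lemma re_two_pi_I_mul (a : ℂ) (x : ℝ) :
    (2 * Real.pi * I * a * x).re = -(2 * Real.pi * a.im * x) := by
  simp

lemma re_mul_sq_le {T : ℝ} (hT : 0 < T) (hT1 : T ≤ 1) (a : ℂ) :
    (Real.pi * T * a ^ 2).re ≤ Real.pi * ‖a‖ ^ 2 := by
  have hpi := Real.pi_pos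
  refine (Complex.re_le_norm _).trans ?_
  rw [norm_mul, norm_mul, norm_pow, Complex.norm_real, Complex.norm_real, Real.norm_eq_abs,
    Real.norm_eq_abs, abs_of_pos hpi, abs_of_pos hT]
  have : 0 ≤ Real.pi * ‖a‖ ^ 2 := by positivity
  nlinarith

lemma neg_im_mul_le (a : ℂ) (x : ℝ) : -(2 * Real.pi * a.im * x) ≤ 2 * Real.pi * ‖a‖ * |x| := by
  have h1 : -(a.im * x) ≤ ‖a‖ * |x| := by
    refine (neg_le_abs _).trans ?_
    rw [abs_mul]
    exact mul_le_mul_of_nonneg_right (abs_im_le_norm a) (abs_nonneg _)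
  have := mul_le_mul_of_nonneg_left h1 Real.two_pi_pos.le
  linarith

lemma tendsto_sqrt_mul_tsum_coeff (a : ℂ) :
    Tendsto (fun T : ℝ => (√T : ℂ) * ∑' j : ℤ, coeff T a j) (𝓝[>] 0) (𝓝 1) := by
  have hpi := Real.pi_pos
  have hle1 : ∀ᶠ T : ℝ in 𝓝[>] 0, T ≤ 1 :=
    mem_nhdsWithin_of_mem_nhds (Iic_mem_nhds (zero_lt_one' ℝ))
  have hnorm : ∀ T : ℝ, 0 < T → T ≤ 1 → ∀ n : ℤ,
      ‖exp (-Real.pi / T * (n : ℂ) ^ 2 + (2 * Real.pi * I * a * n + Real.pi * T * a ^ 2))‖ ≤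
      Real.exp (-Real.pi * (n : ℝ) ^ 2 * T⁻¹ +
        (2 * Real.pi * ‖a‖ * |(n : ℝ)| + Real.pi * ‖a‖ ^ 2)) := by
    intro T hT hT1 n
    rw [Complex.norm_exp]
    refine Real.exp_le_exp.2 ?_
    have e1 : -Real.pi / T * (n : ℂ) ^ 2 = ((-Real.pi * (n : ℝ) ^ 2 * T⁻¹ : ℝ) : ℂ) := by
      push_cast; ring
    have e2 : (n : ℂ) = ((n : ℝ) : ℂ) := by simp
    rw [e1, add_re, add_re, ofReal_re, e2, re_two_pi_I_mul]
    linarith [re_mul_sq_le hT hT1 a, neg_im_mul_le a n]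
  have h : Tendsto (fun T : ℝ => ∑' n : ℤ, exp (-Real.pi / T * (n : ℂ) ^ 2 +
      (2 * Real.pi * I * a * n + Real.pi * T * a ^ 2))) (𝓝[>] 0)
      (𝓝 (∑' n : ℤ, if n = 0 then 1 else 0)) := by
    refine tendsto_tsum_of_dominated_convergence
      (bound := fun n : ℤ => Real.exp (-Real.pi * (n : ℝ) ^ 2 + 2 * Real.pi * ‖a‖ * |(n : ℝ)|) *
        Real.exp (Real.pi * ‖a‖ ^ 2))
      ((summable_exp_neg_sq_add_abs hpi (2 * Real.pi * ‖a‖)).mul_right _) (fun n => ?_) ?_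
    · split_ifs with hn
      · have : Continuous fun T : ℝ => exp (Real.pi * T * a ^ 2) := by fun_prop
        simpa [hn] using (this.tendsto 0).mono_left (nhdsWithin_le_nhds (s := Set.Ioi 0))
      · refine squeeze_zero_norm' (a := fun T : ℝ => Real.exp (-Real.pi * (n : ℝ) ^ 2 * T⁻¹ +
          (2 * Real.pi * ‖a‖ * |(n : ℝ)| + Real.pi * ‖a‖ ^ 2))) ?_ ?_
        · filter_upwards [self_mem_nhdsWithin, hle1] with T hT hT1 using hnorm T hT hT1 n
        · refine Real.tendsto_exp_atBot.comp (tendsto_atBot_add_const_right _ _ ?_)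
          refine tendsto_inv_nhdsGT_zero.const_mul_atTop_of_neg ?_
          have : (0 : ℝ) < (n : ℝ) ^ 2 := by positivity
          nlinarith
    · filter_upwards [self_mem_nhdsWithin, hle1] with T (hT : 0 < T) hT1 n
      refine (hnorm T hT hT1 n).trans ?_
      rw [← Real.exp_add, add_assoc]
      refine Real.exp_le_exp.2 (add_le_add_left ?_ _)
      have h1 : 1 ≤ T⁻¹ := (one_le_inv₀ hT).2 hT1
      have h2 : 0 ≤ Real.pi * (n : ℝ) ^ 2 := by positivity
      nlinarith
  rw [tsum_ite_eq] at h
  refine h.congr' ?_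
  filter_upwards [self_mem_nhdsWithin] with T hT
  rw [sqrt_mul_tsum_coeff hT]

/-- The sign `e^{πij}` moves the dual lattice to the half-integers, so every dual term carries at
least the factor `e^{-π/(4T)}`. -/
lemma sqrt_mul_tsum_neg_one_zpow_mul_coeff {T : ℝ} (hT : 0 < T) (a : ℂ) :
    (√T : ℂ) * ∑' j : ℤ, (-1 : ℂ) ^ j * coeff T a j =
      ∑' n : ℤ, exp (-Real.pi / T * ((n : ℂ) - 1 / 2) ^ 2 +
        (2 * Real.pi * I * a * (n - 1 / 2) + Real.pi * T * a ^ 2)) := by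
  have hT' : (T : ℂ) ≠ 0 := by exact_mod_cast hT.ne'
  have hs : ((√T : ℝ) : ℂ) ≠ 0 := by exact_mod_cast (Real.sqrt_pos.2 hT).ne'
  have h := Complex.tsum_exp_neg_quadratic (a := (T : ℂ)) (by simpa using hT) (-T * a + I / 2)
  rw [ofReal_cpow_half hT] at h
  have e1 : ∀ j : ℤ, (-1 : ℂ) ^ j * coeff T a j =
      exp (-Real.pi * T * (j : ℂ) ^ 2 + 2 * Real.pi * (-T * a + I / 2) * j) := fun j => by
    rw [coeff, neg_one_zpow_eq_exp, ← Complex.exp_add]; congr 1; ring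
  simp_rw [e1]
  rw [h, ← mul_assoc, mul_one_div_cancel hs, one_mul]
  refine tsum_congr fun n => ?_
  congr 1
  have e2 : (n : ℂ) + I * (-T * a + I / 2) = n - 1 / 2 - T * a * I := by
    linear_combination (1 / 2 : ℂ) * I_sq
  rw [e2]
  field_simp
  linear_combination -(4 * (T : ℂ) ^ 2 * a ^ 2) * I_sq

lemma tendsto_exp_mul_tsum_neg_one_zpow_mul_coeff (a : ℂ) :
    Tendsto (fun T : ℝ => (T : ℂ) * exp (Real.pi / (4 * T)) * ∑' j : ℤ, (-1 : ℂ) ^ j * coeff T a j)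
      (𝓝[>] 0) (𝓝 0) := by
  have hpi := Real.pi_pos
  -- A bound independent of `T ≤ 1`: `π|n|` comes from `1/4 - (n - 1/2)² = -(n² - n)`, the terms
  -- linear in `‖a‖` from `|n - 1/2| ≤ |n| + 1/2`, and `π‖a‖²` from `πTa²`.
  set S := ∑' n : ℤ, Real.exp (-Real.pi * (n : ℝ) ^ 2 +
    (Real.pi + 2 * Real.pi * ‖a‖) * |(n : ℝ)|) * Real.exp (Real.pi * ‖a‖ + Real.pi * ‖a‖ ^ 2)
  have hsqrt : Tendsto (fun T : ℝ => √T * S) (𝓝[>] 0) (𝓝 0) := by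
    have := (Real.continuous_sqrt.tendsto 0).mono_left (nhdsWithin_le_nhds (s := Set.Ioi 0))
    simpa using this.mul_const S
  refine squeeze_zero_norm' ?_ hsqrt
  filter_upwards [self_mem_nhdsWithin,
    mem_nhdsWithin_of_mem_nhds (Iic_mem_nhds (zero_lt_one' ℝ))] with T (hT : 0 < T) hT1
  have e0 : (T : ℂ) = √T * √T := by
    rw [← ofReal_mul, Real.mul_self_sqrt hT.le]
  have e1 : (T : ℂ) * exp (Real.pi / (4 * T)) * ∑' j : ℤ, (-1 : ℂ) ^ j * coeff T a j =
      √T * ∑' n : ℤ, exp (Real.pi / (4 * T)) * exp (-Real.pi / T * ((n : ℂ) - 1 / 2) ^ 2 +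
        (2 * Real.pi * I * a * (n - 1 / 2) + Real.pi * T * a ^ 2)) := by
    rw [tsum_mul_left, ← sqrt_mul_tsum_neg_one_zpow_mul_coeff hT]
    nth_rewrite 1 [e0]
    ring
  rw [e1, norm_mul, Complex.norm_real, Real.norm_eq_abs, abs_of_nonneg (Real.sqrt_nonneg T)]
  refine mul_le_mul_of_nonneg_left ?_ (Real.sqrt_nonneg T)
  refine tsum_of_norm_bounded ((summable_exp_neg_sq_add_abs hpi
    (Real.pi + 2 * Real.pi * ‖a‖)).mul_right _).hasSum fun n => ?_
  rw [← Complex.exp_add, ← Real.exp_add, Complex.norm_exp]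
  refine Real.exp_le_exp.2 ?_
  have hT' : (T : ℂ) ≠ 0 := by exact_mod_cast hT.ne'
  have e2 : (Real.pi : ℂ) / (4 * T) + (-Real.pi / T * ((n : ℂ) - 1 / 2) ^ 2 +
        (2 * Real.pi * I * a * (n - 1 / 2) + Real.pi * T * a ^ 2)) =
      ((-Real.pi * ((n : ℝ) ^ 2 - n) * T⁻¹ : ℝ) : ℂ) +
        (2 * Real.pi * I * a * ((n - 1 / 2 : ℝ) : ℂ) + Real.pi * T * a ^ 2) := by
    push_cast
    field_simp
    ring
  rw [e2, add_re, add_re, ofReal_re, re_two_pi_I_mul]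
  have h1 := neg_im_mul_le a (n - 1 / 2)
  have h2 := re_mul_sq_le hT hT1 a
  have h3 : |(n : ℝ) - 1 / 2| ≤ |(n : ℝ)| + 1 / 2 := by
    refine (abs_sub _ _).trans ?_
    rw [abs_of_pos (one_half_pos (α := ℝ))]
  have h3' := mul_le_mul_of_nonneg_left h3 (mul_nonneg Real.two_pi_pos.le (norm_nonneg a))
  have h4 : 0 ≤ (n : ℝ) ^ 2 - n := by
    have : 0 ≤ n ^ 2 - n := by
      rcases le_or_gt n 0 with h | h <;> nlinarith
    exact_mod_cast this
  have h5 : 1 ≤ T⁻¹ := (one_le_inv₀ hT).2 hT1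
  have h6 : Real.pi * ((n : ℝ) ^ 2 - n) ≤ Real.pi * ((n : ℝ) ^ 2 - n) * T⁻¹ :=
    le_mul_of_one_le_right (mul_nonneg hpi.le h4) h5
  have h7 := mul_le_mul_of_nonneg_left (le_abs_self (n : ℝ)) hpi.le
  linarith

/-! ### Sums with denominator `cosh` -/

lemma cosh_pi_mul_ne_zero {T : ℝ} {a : ℂ} (h : |Real.pi * T * a.im| ≤ 1) (j : ℤ) :
    cosh (Real.pi * T * (j + a)) ≠ 0 := by
  refine cosh_ne_zero_of_abs_im_lt ?_
  rw [im_pi_mul]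
  linarith [Real.pi_gt_three]

lemma exp_div_two_cosh {w : ℂ} (hw : cosh w ≠ 0) :
    exp w / (2 * cosh w) = 1 / 2 + sinh w / cosh w / 2 := by
  rw [← Complex.cosh_add_sinh]; field_simp

/-- Used for `g₂`: the term `e^w` sums to a theta series, and `1 / cosh w` is a kernel to which
Poisson summation applies. -/
lemma exp_two_mul_div_two_cosh {w : ℂ} (hw : cosh w ≠ 0) :
    exp (2 * w) / (2 * cosh w) = exp w - 1 / cosh w / 2 := by
  have h : exp (2 * w) = exp w * (2 * cosh w) - 1 := by
    have h1 : exp w * exp (-w) = 1 := by rw [← Complex.exp_add]; simp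
    have h2 : exp (2 * w) = exp w * exp w := by rw [← Complex.exp_add]; ring_nf
    rw [Complex.cosh, h2]
    linear_combination -h1
  rw [h]; field_simp

lemma self_le_exp_sq (x : ℝ) : x ≤ Real.exp (x ^ 2) := by
  nlinarith [Real.add_one_le_exp (x ^ 2), sq_nonneg (x - 1)]

lemma norm_pi_mul_le {T : ℝ} (hT : 0 < T) (j : ℤ) (a : ℂ) :
    ‖(Real.pi : ℂ) * T * (j + a)‖ ≤ Real.pi * T * (|(j : ℝ)| + ‖a‖) := by
  rw [norm_mul, norm_mul, Complex.norm_real, Complex.norm_real, Real.norm_eq_abs,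
    Real.norm_eq_abs, abs_of_pos Real.pi_pos, abs_of_pos hT]
  refine mul_le_mul_of_nonneg_left ((norm_add_le _ _).trans ?_) (mul_pos Real.pi_pos hT).le
  rw [Complex.norm_intCast]

lemma tendsto_sqrt_mul_tsum_coeff_mul_tanh (a : ℂ) :
    Tendsto (fun T : ℝ => ∑' j : ℤ, (√T : ℂ) * (coeff T a j *
      (sinh (Real.pi * T * (j + a)) / cosh (Real.pi * T * (j + a))))) (𝓝[>] 0) (𝓝 0) := by
  obtain ⟨K, hK, hb⟩ := exists_bound_tanh
  have hpi := Real.pi_pos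
  -- Since `tanh w = O(T(|j| + ‖a‖))`, the factor `√T |j|` must be absorbed; it is at most
  -- `e^{Tj²}`, which costs `1` out of `π` in the Gaussian.
  refine tendsto_tsum_zero_of_gaussian_bound (δ := Real.pi - 1) (K := 2 * Real.pi * ‖a‖)
    (B := K * Real.pi * (1 + ‖a‖)) (by linarith [Real.pi_gt_three]) (s := id) (fun T h => h.le)
    tendsto_self_div_sqrt ?_
  filter_upwards [self_mem_nhdsWithin, eventually_mul_abs_le_one a.im,
    mem_nhdsWithin_of_mem_nhds (Iic_mem_nhds (zero_lt_one' ℝ))] with T (hT : 0 < T) him hT1 j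
  have h1 := hb (Real.pi * T * (j + a)) (by rw [im_pi_mul]; exact him)
  rw [norm_mul, norm_mul, Complex.norm_real, Real.norm_eq_abs, abs_of_nonneg (Real.sqrt_nonneg T),
    id]
  have h2 : √T * |(j : ℝ)| ≤ Real.exp (T * (j : ℝ) ^ 2) := by
    have := self_le_exp_sq (√T * |(j : ℝ)|)
    rwa [mul_pow, Real.sq_sqrt hT.le, sq_abs] at this
  have h3 : √T ≤ Real.exp (T * (j : ℝ) ^ 2) :=
    (Real.sqrt_le_one.2 hT1).trans (Real.one_le_exp (by positivity))
  have h4 : √T * (|(j : ℝ)| + ‖a‖) ≤ (1 + ‖a‖) * Real.exp (T * (j : ℝ) ^ 2) := by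
    nlinarith [mul_le_mul_of_nonneg_right h3 (norm_nonneg a)]
  calc _ ≤ √T * (Real.exp (T * (-Real.pi * (j : ℝ) ^ 2 + 2 * Real.pi * ‖a‖ * |(j : ℝ)|)) *
        (K * (Real.pi * T * (|(j : ℝ)| + ‖a‖)))) := by
        refine mul_le_mul_of_nonneg_left (mul_le_mul (norm_coeff_le hT a j) (h1.trans ?_)
          (norm_nonneg _) (Real.exp_pos _).le) (Real.sqrt_nonneg T)
        exact mul_le_mul_of_nonneg_left (norm_pi_mul_le hT j a) hK
    _ = K * Real.pi * T * (Real.exp (T * (-Real.pi * (j : ℝ) ^ 2 +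
          2 * Real.pi * ‖a‖ * |(j : ℝ)|)) * (√T * (|(j : ℝ)| + ‖a‖))) := by ring
    _ ≤ K * Real.pi * T * (Real.exp (T * (-Real.pi * (j : ℝ) ^ 2 +
          2 * Real.pi * ‖a‖ * |(j : ℝ)|)) * ((1 + ‖a‖) * Real.exp (T * (j : ℝ) ^ 2))) := by
        gcongr
    _ = K * Real.pi * (1 + ‖a‖) * T * (Real.exp (T * (-Real.pi * (j : ℝ) ^ 2 +
          2 * Real.pi * ‖a‖ * |(j : ℝ)|)) * Real.exp (T * (j : ℝ) ^ 2)) := by ring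
    _ = _ := by rw [← Real.exp_add]; ring_nf

lemma norm_le_exp_mul_abs {T : ℝ} (hT : 0 < T) (j : ℤ) (a : ℂ) {K : ℝ} (hK : 0 ≤ K) {x : ℂ}
    (hx : ‖x‖ ≤ K * ‖(Real.pi : ℂ) * T * (j + a)‖) :
    ‖x‖ ≤ K * Real.pi * T * (1 + ‖a‖) * Real.exp (1 * |(j : ℝ)|) := by
  have h1 : |(j : ℝ)| + ‖a‖ ≤ (1 + ‖a‖) * Real.exp (1 * |(j : ℝ)|) := by
    rw [one_mul]
    have h2 := Real.add_one_le_exp |(j : ℝ)|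
    have h3 := abs_nonneg (j : ℝ)
    nlinarith [norm_nonneg a, mul_nonneg (norm_nonneg a) (sub_nonneg.2 h2),
      mul_nonneg (norm_nonneg a) h3]
  have hpi := Real.pi_pos
  calc ‖x‖ ≤ K * (Real.pi * T * (|(j : ℝ)| + ‖a‖)) :=
        hx.trans (mul_le_mul_of_nonneg_left (norm_pi_mul_le hT j a) hK)
    _ ≤ K * (Real.pi * T * ((1 + ‖a‖) * Real.exp (1 * |(j : ℝ)|))) := by gcongr
    _ = _ := by ring

lemma summable_coeff {T : ℝ} (hT : 0 < T) (a : ℂ) : Summable fun j => coeff T a j := by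
  simpa using summable_coeff_mul hT a (G := fun _ => 1) (B := 1) (K := 0) (by simp)

lemma summable_coeff_mul_tanh {T : ℝ} (hT : 0 < T) {a : ℂ} (h : |Real.pi * T * a.im| ≤ 1) :
    Summable fun j : ℤ => coeff T a j *
      (sinh (Real.pi * T * (j + a)) / cosh (Real.pi * T * (j + a))) := by
  obtain ⟨K, hK, hb⟩ := exists_bound_tanh
  exact summable_coeff_mul hT a (B := K * Real.pi * T * (1 + ‖a‖)) (K := 1) fun j =>
    norm_le_exp_mul_abs hT j a hK (hb _ (by rw [im_pi_mul]; exact h))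

lemma tendsto_sqrt_mul_tsum_exp_div_cosh (a : ℂ) :
    Tendsto (fun T : ℝ => (√T : ℂ) * ∑' j : ℤ, coeff T a j *
      (exp (Real.pi * T * (j + a)) / (2 * cosh (Real.pi * T * (j + a))))) (𝓝[>] 0)
      (𝓝 (1 / 2)) := by
  have h := ((tendsto_sqrt_mul_tsum_coeff a).add
    (tendsto_sqrt_mul_tsum_coeff_mul_tanh a)).div_const 2
  rw [add_zero] at h
  refine h.congr' ?_
  filter_upwards [self_mem_nhdsWithin, eventually_mul_abs_le_one a.im] with T hT him
  rw [tsum_mul_left, ← mul_add, ← (summable_coeff hT a).tsum_add (summable_coeff_mul_tanh hT him),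
    mul_div_assoc, ← tsum_div_const]
  congr 1
  refine tsum_congr fun j => ?_
  rw [exp_div_two_cosh (cosh_pi_mul_ne_zero him j)]
  ring

/-! ### Shifting horizontal contours -/

/-- Cauchy's theorem on long rectangles, whose vertical sides vanish in the limit. Only the
difference is assumed integrable, since the lemma is also applied to a function with a `1/y` tail,
not integrable on a single line. -/
lemma integral_sub_eq_zero_of_strip {H : ℂ → ℂ} {c d : ℝ}
    (hd : DifferentiableOn ℂ H {z | z.im ∈ Set.uIcc c d})
    (hz : ∀ ε > 0, ∃ R, ∀ x y : ℝ, R ≤ |x| → y ∈ Set.uIcc c d → ‖H (x + y * I)‖ ≤ ε)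
    (hi : Integrable fun x : ℝ => H (x + c * I) - H (x + d * I)) :
    ∫ x : ℝ, (H (x + c * I) - H (x + d * I)) = 0 := by
  have hcont : ∀ s ∈ Set.uIcc c d, Continuous fun x : ℝ => H (x + s * I) := fun s hs =>
    hd.continuousOn.comp_continuous (by fun_prop) fun x => by simpa using hs
  have hrect : ∀ R : ℝ, ∫ x in (-R)..R, (H (x + c * I) - H (x + d * I)) =
      I • (∫ y in c..d, H ((-R : ℝ) + y * I)) - I • (∫ y in c..d, H (R + y * I)) := by
    intro R
    have h := integral_boundary_rect_eq_zero_of_differentiableOn H ((-R : ℝ) + c * I) (R + d * I)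
      (hd.mono fun z hz => by simpa using hz.2)
    rw [intervalIntegral.integral_sub
      ((hcont c Set.left_mem_uIcc).intervalIntegrable _ _)
      ((hcont d Set.right_mem_uIcc).intervalIntegrable _ _)]
    have e1 : ((-R : ℝ) + c * I : ℂ).re = -R := by simp
    have e2 : ((-R : ℝ) + c * I : ℂ).im = c := by simp
    have e3 : (R + d * I : ℂ).re = R := by simp
    have e4 : (R + d * I : ℂ).im = d := by simp
    rw [e1, e2, e3, e4] at h
    linear_combination h
  have hlim := intervalIntegral_tendsto_integral hi tendsto_neg_atTop_atBot tendsto_id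
  refine tendsto_nhds_unique hlim (Metric.tendsto_atTop.2 fun ε hε => ?_)
  obtain ⟨R, hR⟩ := hz (ε / (4 * (|d - c| + 1))) (by positivity)
  refine ⟨max R 0, fun r hr => ?_⟩
  have hr0 : 0 ≤ r := (le_max_right _ _).trans hr
  have hr1 : R ≤ r := (le_max_left _ _).trans hr
  have h1 : ∀ s : ℝ, |s| = r → ‖∫ y in c..d, H (s + y * I)‖ ≤
      ε / (4 * (|d - c| + 1)) * |d - c| := fun s hs =>
    intervalIntegral.norm_integral_le_of_norm_le_const fun y hy =>
      hR s y (hs ▸ hr1) (Set.uIoc_subset_uIcc hy)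
  have h2 : ε / (4 * (|d - c| + 1)) * |d - c| ≤ ε / 4 := by
    have : (0 : ℝ) < |d - c| + 1 := by positivity
    rw [div_mul_eq_mul_div, div_le_div_iff₀ (by positivity) (by positivity)]
    nlinarith
  have h3 := h1 (-r) (by rw [abs_neg, abs_of_nonneg hr0])
  have h4 := h1 r (abs_of_nonneg hr0)
  rw [dist_zero_right, id, hrect]
  refine (norm_sub_le _ _).trans_lt ?_
  rw [norm_smul, norm_smul, norm_I, one_mul, one_mul]
  linarith

/-! ### Mordell integrals -/

/-- The numerators `N` (`1` and `sinh`) for which `N / cosh` is `±1`-periodic under `w ↦ w + πi`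
and of the opposite parity. -/
structure IsNumerator (N : ℂ → ℂ) (κ : ℂ) : Prop where
  differentiable : Differentiable ℂ N
  norm_le : ∀ w, ‖N w‖ ≤ Real.cosh w.re
  add_pi_mul_I : ∀ w, N (w + Real.pi * I) = -κ * N w
  neg : ∀ w, N (-w) = -κ * N w
  sq : κ ^ 2 = 1

lemma isNumerator_one : IsNumerator (fun _ => 1) (-1) where
  differentiable := by fun_prop
  norm_le w := by simp
  add_pi_mul_I w := by simp
  neg w := by simp
  sq := by norm_num

lemma isNumerator_sinh : IsNumerator sinh 1 where
  differentiable := Complex.differentiable_sinh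
  norm_le := norm_sinh_le_cosh_re
  add_pi_mul_I w := by
    rw [Complex.sinh_add, Complex.cosh_mul_I, Complex.sinh_mul_I, Complex.cos_pi, Complex.sin_pi]
    ring
  neg w := by rw [Complex.sinh_neg]; ring
  sq := by norm_num

lemma IsNumerator.norm_eq_one {N : ℂ → ℂ} {κ : ℂ} (h : IsNumerator N κ) : ‖κ‖ = 1 := by
  have h1 := congrArg norm h.sq
  rw [norm_pow, norm_one] at h1
  exact (pow_eq_one_iff_of_nonneg (norm_nonneg _) two_ne_zero).1 h1

lemma cosh_add_pi_mul_I (w : ℂ) : cosh (w + Real.pi * I) = -cosh w := by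
  rw [Complex.cosh_add, Complex.cosh_mul_I, Complex.sinh_mul_I, Complex.cos_pi, Complex.sin_pi]
  ring

/-- The quotient `N(πy) / cosh(πy)`. -/
def kernel (N : ℂ → ℂ) (y : ℂ) : ℂ := N (Real.pi * y) / cosh (Real.pi * y)

/-- The integrand of the Mordell integral. -/
def integrand (N : ℂ → ℂ) (t ξ : ℝ) (y : ℂ) : ℂ :=
  exp (-Real.pi * t * y ^ 2 + 2 * Real.pi * t * ξ * y * I) * kernel N y

/-- The Mordell integral `∫ exp(-πty² + 2πitξy) N(πy) / cosh(πy) dy`. -/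
def mordell (N : ℂ → ℂ) (t ξ : ℝ) : ℂ := ∫ x : ℝ, integrand N t ξ x

lemma im_pi_mul' (y : ℂ) : ((Real.pi : ℂ) * y).im = Real.pi * y.im := im_ofReal_mul _ _

lemma cosh_pi_mul_ne_zero' {y : ℂ} (hy : |y.im| < 1 / 2) : cosh (Real.pi * y) ≠ 0 := by
  refine cosh_ne_zero_of_abs_im_lt ?_
  rw [im_pi_mul', abs_mul, abs_of_pos Real.pi_pos]
  nlinarith [Real.pi_pos]

lemma norm_exp_quadratic (t ξ x y : ℝ) :
    ‖exp (-Real.pi * t * ((x : ℂ) + y * I) ^ 2 + 2 * Real.pi * t * ξ * ((x : ℂ) + y * I) * I)‖ =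
      Real.exp (-(Real.pi * t) * x ^ 2) *
        Real.exp (Real.pi * t * y ^ 2 - 2 * Real.pi * t * ξ * y) := by
  rw [Complex.norm_exp, ← Real.exp_add]
  congr 1
  have : (-Real.pi * t * ((x : ℂ) + y * I) ^ 2 + 2 * Real.pi * t * ξ * ((x : ℂ) + y * I) * I) =
      ((-(Real.pi * t) * x ^ 2 + (Real.pi * t * y ^ 2 - 2 * Real.pi * t * ξ * y) : ℝ) : ℂ) +
        ((-(2 * Real.pi * t * x * y) + 2 * Real.pi * t * ξ * x : ℝ) : ℂ) * I := by
    push_cast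
    linear_combination (-Real.pi * t * (y : ℂ) ^ 2 + 2 * Real.pi * t * ξ * y) * I_sq
  rw [this, add_re, ofReal_re, re_ofReal_mul, I_re, mul_zero, add_zero]

section

variable {N : ℂ → ℂ} {κ : ℂ} {t : ℝ}

/-- Uniform in `y`, hence usable on vertical sides that reach beyond the height of the pole `i/2`.
-/
lemma norm_kernel_le_two (hN : IsNumerator N κ) {x y : ℝ} (hx : 1 ≤ |x|) :
    ‖kernel N (x + y * I)‖ ≤ 2 := by
  have hre : ((Real.pi : ℂ) * (x + y * I)).re = Real.pi * x := by rw [re_ofReal_mul]; simp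
  have h1 : 1 ≤ |((Real.pi : ℂ) * (x + y * I)).re| := by
    rw [hre, abs_mul, abs_of_pos Real.pi_pos]
    nlinarith [Real.pi_gt_three]
  have hs := one_le_abs_sinh h1
  have h3 := abs_sinh_re_le_norm_cosh (Real.pi * (x + y * I))
  rw [kernel, norm_div, div_le_iff₀ (by linarith)]
  have := hN.norm_le (Real.pi * (x + y * I))
  have := cosh_le_two_mul_abs_sinh h1
  linarith

lemma differentiableOn_kernel (hN : IsNumerator N κ) :
    DifferentiableOn ℂ (kernel N) {y | |y.im| < 1 / 2} := by
  unfold kernel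
  refine DifferentiableOn.div ?_ ?_ fun y hy => cosh_pi_mul_ne_zero' hy
  · exact (hN.differentiable.comp (differentiable_id.const_mul _)).differentiableOn
  · exact (Complex.differentiable_cosh.comp (differentiable_id.const_mul _)).differentiableOn

lemma continuous_kernel_line (hN : IsNumerator N κ) {c : ℝ} (hc : |c| < 1 / 2) :
    Continuous fun x : ℝ => kernel N (x + c * I) :=
  (differentiableOn_kernel hN).continuousOn.comp_continuous (by fun_prop) fun x => by
    simpa using hc

lemma exists_norm_kernel_le (hN : IsNumerator N κ) {c : ℝ} (hc : |c| < 1 / 2) :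
    ∃ C, ∀ x : ℝ, ‖kernel N (x + c * I)‖ ≤ C := by
  obtain ⟨C, hC⟩ := isCompact_Icc.exists_bound_of_continuousOn
    (s := Set.Icc (-1 : ℝ) 1) (continuous_kernel_line hN hc).continuousOn
  refine ⟨max C 2, fun x => ?_⟩
  rcases le_total |x| 1 with h | h
  · exact (hC x (abs_le.1 h)).trans (le_max_left _ _)
  · exact (norm_kernel_le_two hN h).trans (le_max_right _ _)

lemma differentiableOn_integrand (hN : IsNumerator N κ) (t ξ : ℝ) :
    DifferentiableOn ℂ (integrand N t ξ) {y | |y.im| < 1 / 2} :=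
  DifferentiableOn.mul (by fun_prop) (differentiableOn_kernel hN)

lemma integrable_integrand (hN : IsNumerator N κ) (ht : 0 < t) (ξ : ℝ) {c : ℝ}
    (hc : |c| < 1 / 2) : Integrable fun x : ℝ => integrand N t ξ (x + c * I) := by
  obtain ⟨C, hC⟩ := exists_norm_kernel_le hN hc
  have hcont : Continuous fun x : ℝ => integrand N t ξ (x + c * I) :=
    (differentiableOn_integrand hN t ξ).continuousOn.comp_continuous (by fun_prop) fun x => by
      simpa using hc
  refine Integrable.mono' (((integrable_exp_neg_mul_sq (mul_pos Real.pi_pos ht)).mul_const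
    (Real.exp (Real.pi * t * c ^ 2 - 2 * Real.pi * t * ξ * c))).mul_const C)
    hcont.aestronglyMeasurable (Eventually.of_forall fun x => ?_)
  rw [integrand, norm_mul, norm_exp_quadratic]
  exact mul_le_mul_of_nonneg_left (hC x) (by positivity)

lemma integrand_decay (hN : IsNumerator N κ) (ht : 0 < t) (ξ c d : ℝ) {ε : ℝ} (hε : 0 < ε) :
    ∃ R, 1 ≤ R ∧ ∀ x y : ℝ, R ≤ |x| → y ∈ Set.uIcc c d → ‖integrand N t ξ (x + y * I)‖ ≤ ε := by
  obtain ⟨B, hB⟩ := isCompact_uIcc.exists_bound_of_continuousOn (s := Set.uIcc c d)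
    (f := fun y : ℝ => Real.exp (Real.pi * t * y ^ 2 - 2 * Real.pi * t * ξ * y))
    (by fun_prop : Continuous _).continuousOn
  have hlim : Tendsto (fun x : ℝ => Real.exp (-(Real.pi * t) * x) * (|B| * 2)) atTop (𝓝 0) := by
    have h1 : Tendsto (fun x : ℝ => Real.exp (-(Real.pi * t) * x)) atTop (𝓝 0) :=
      Real.tendsto_exp_atBot.comp (tendsto_id.const_mul_atTop_of_neg
        (neg_lt_zero.2 (mul_pos Real.pi_pos ht)))
    simpa using h1.mul_const (|B| * 2)
  obtain ⟨R, hR⟩ := (hlim.eventually (Iio_mem_nhds hε)).exists_forall_of_atTop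
  refine ⟨max R 1, le_max_right _ _, fun x y hx hy => ?_⟩
  have hx1 : 1 ≤ |x| := (le_max_right _ _).trans hx
  have h1 := hR |x| ((le_max_left _ _).trans hx)
  refine le_trans ?_ (le_of_lt h1)
  rw [integrand, norm_mul, norm_exp_quadratic, mul_assoc]
  have h2 : Real.exp (-(Real.pi * t) * x ^ 2) ≤ Real.exp (-(Real.pi * t) * |x|) := by
    refine Real.exp_le_exp.2 ?_
    rw [← sq_abs x]
    have := mul_pos Real.pi_pos ht
    nlinarith [mul_nonneg this.le (mul_nonneg (abs_nonneg x) (sub_nonneg.2 hx1))]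
  have h3 := hB y hy
  rw [Real.norm_eq_abs, abs_of_pos (Real.exp_pos _)] at h3
  exact mul_le_mul h2 (mul_le_mul (h3.trans (le_abs_self B)) (norm_kernel_le_two hN hx1)
    (norm_nonneg _) (abs_nonneg _)) (by positivity) (by positivity)

/-- No pole lies in `|Im y| < 1/2`. For non-real `a` the Fourier integral runs along such a shifted
line. -/
lemma integral_integrand_line (hN : IsNumerator N κ) (ht : 0 < t) (ξ : ℝ) {c : ℝ}
    (hc : |c| < 1 / 2) : ∫ x : ℝ, integrand N t ξ (x + c * I) = mordell N t ξ := by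
  have h0 : |(0 : ℝ)| < 1 / 2 := by norm_num
  have h := integral_sub_eq_zero_of_strip (H := integrand N t ξ) (c := c) (d := 0)
    ((differentiableOn_integrand hN t ξ).mono fun z hz => ?_) (fun ε hε => ?_)
    ((integrable_integrand hN ht ξ hc).sub (integrable_integrand hN ht ξ h0))
  · rw [integral_sub (integrable_integrand hN ht ξ hc) (integrable_integrand hN ht ξ h0),
      sub_eq_zero] at h
    simpa [mordell] using h
  · have h1 := Set.abs_sub_left_of_mem_uIcc hz
    have h2 := Set.abs_sub_right_of_mem_uIcc hz
    simp only [zero_sub, abs_neg] at h1 h2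
    exact lt_of_le_of_lt h2 hc
  · obtain ⟨R, -, hR⟩ := integrand_decay hN ht ξ c 0 hε
    exact ⟨R, hR⟩

lemma integrand_add_I (hN : IsNumerator N κ) (t ξ : ℝ) (y : ℂ) :
    integrand N t ξ (y + I) =
      κ * Real.exp (Real.pi * t * (1 - 2 * ξ)) * integrand N t (ξ - 1) y := by
  have h1 : kernel N (y + I) = κ * kernel N y := by
    rw [kernel, kernel, mul_add, hN.add_pi_mul_I, cosh_add_pi_mul_I]
    ring
  rw [integrand, integrand, h1]
  have h2 : exp (-Real.pi * t * (y + I) ^ 2 + 2 * Real.pi * t * ξ * (y + I) * I) =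
      Real.exp (Real.pi * t * (1 - 2 * ξ)) *
        exp (-Real.pi * t * y ^ 2 + 2 * Real.pi * t * (ξ - 1 : ℝ) * y * I) := by
    rw [ofReal_exp, ← Complex.exp_add]
    congr 1
    push_cast
    linear_combination (-Real.pi * t + 2 * Real.pi * t * ξ) * I_sq
  rw [h2]
  ring

lemma integrand_neg (hN : IsNumerator N κ) (t ξ : ℝ) (y : ℂ) :
    integrand N t ξ (-y) = -κ * integrand N t (-ξ) y := by
  have h1 : kernel N (-y) = -κ * kernel N y := by
    rw [kernel, kernel, mul_neg, hN.neg, Complex.cosh_neg]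
    ring
  rw [integrand, integrand, h1]
  push_cast
  ring_nf

lemma mordell_neg (hN : IsNumerator N κ) (t ξ : ℝ) :
    mordell N t (-ξ) = -κ * mordell N t ξ := by
  have h : mordell N t ξ = -κ * mordell N t (-ξ) := by
    rw [mordell, mordell, ← integral_const_mul, ← integral_neg_eq_self]
    refine integral_congr_ae (Eventually.of_forall fun x => ?_)
    simp only [ofReal_neg]
    exact integrand_neg hN t ξ x
  rw [h]
  linear_combination (-mordell N t (-ξ)) * hN.sq

lemma integrable_inv_sq_add_quarter : Integrable fun x : ℝ => (x ^ 2 + 1 / 4)⁻¹ := by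
  have h := (integrable_inv_one_add_sq.comp_mul_left' (two_ne_zero' ℝ)).const_mul 4
  refine h.congr (Eventually.of_forall fun x => ?_)
  simp only
  rw [show (1 + (2 * x) ^ 2) = 4 * (x ^ 2 + 1 / 4) by ring, mul_inv]
  ring

lemma integral_inv_sq_add_quarter : ∫ x : ℝ, (x ^ 2 + 1 / 4)⁻¹ = 2 * Real.pi := by
  have h := Measure.integral_comp_mul_left (fun x : ℝ => (1 + x ^ 2)⁻¹) 2
  rw [integral_univ_inv_one_add_sq] at h
  have e1 : ∀ x : ℝ, (x ^ 2 + 1 / 4)⁻¹ = 4 * (1 + (2 * x) ^ 2)⁻¹ := fun x => by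
    rw [show (1 + (2 * x) ^ 2) = 4 * (x ^ 2 + 1 / 4) by ring, mul_inv]; ring
  simp_rw [e1]
  rw [integral_const_mul, h, smul_eq_mul, abs_of_pos (by norm_num)]
  ring

/-- The polar part at `i/2` compared on the lines `Im y = 0` and `Im y = 1`. Its integral is `2πi`,
which is how the residue enters. -/
lemma inv_sub_half_I_sub_inv_add_half_I (x : ℝ) :
    ((x : ℂ) - I / 2)⁻¹ - ((x : ℂ) + I / 2)⁻¹ = I * ((x ^ 2 + 1 / 4 : ℝ)⁻¹ : ℝ) := by
  have h1 : (x : ℂ) - I / 2 ≠ 0 := fun h => by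
    have := congrArg im h; norm_num at this
  have h2 : (x : ℂ) + I / 2 ≠ 0 := fun h => by
    have := congrArg im h; norm_num at this
  have h3 : ((x ^ 2 + 1 / 4 : ℝ) : ℂ) = (x - I / 2) * (x + I / 2) := by
    push_cast; linear_combination (1 / 4 : ℂ) * I_sq
  rw [ofReal_inv, h3, inv_sub_inv h1 h2, div_eq_mul_inv]
  congr 1
  ring

end

/-! ### The functional equation of the Mordell integral and its size at half-integers -/

section

variable {N : ℂ → ℂ} {κ : ℂ} {t : ℝ}

lemma cosh_eq_I_mul_sinh (w : ℂ) : cosh w = I * sinh (w - Real.pi / 2 * I) := by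
  rw [Complex.sinh_sub, Complex.cosh_mul_I, Complex.sinh_mul_I, Complex.cos_pi_div_two,
    Complex.sin_pi_div_two]
  linear_combination cosh w * I_sq

lemma cosh_pi_mul_ne_zero_of_ne {y : ℂ} (h1 : -(1 / 2) < y.im) (h2 : y.im < 3 / 2)
    (hy : y ≠ I / 2) : cosh (Real.pi * y) ≠ 0 := by
  have hpi : (Real.pi : ℂ) ≠ 0 := by exact_mod_cast Real.pi_pos.ne'
  have e : (Real.pi : ℂ) * y - Real.pi / 2 * I = Real.pi * (y - I / 2) := by ring
  rw [cosh_eq_I_mul_sinh, e]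
  refine mul_ne_zero I_ne_zero (sinh_ne_zero_of_abs_im_lt
    (mul_ne_zero hpi (sub_ne_zero.2 hy)) ?_)
  have him : (y - I / 2).im = y.im - 1 / 2 := by simp
  rw [im_pi_mul', abs_mul, abs_of_pos Real.pi_pos, him]
  refine mul_lt_of_lt_one_right Real.pi_pos (abs_lt.2 ⟨by linarith, by linarith⟩)

/-- The pole of `integrand` at `i/2` is simple. -/
lemma exists_integrand_eq_residue_add (hN : IsNumerator N κ) (t ξ : ℝ) :
    ∃ H : ℂ → ℂ, DifferentiableOn ℂ H {y | -(1 / 2) < y.im ∧ y.im < 3 / 2} ∧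
      ∀ y, y ≠ I / 2 → H y = integrand N t ξ y -
        Real.exp (Real.pi * t / 4 - Real.pi * t * ξ) * N (Real.pi * I / 2) / (Real.pi * I) *
          (y - I / 2)⁻¹ := by
  set U : Set ℂ := {y | -(1 / 2) < y.im ∧ y.im < 3 / 2}
  have hUo : IsOpen U :=
    (isOpen_lt continuous_const continuous_im).inter (isOpen_lt continuous_im continuous_const)
  have hU : U ∈ 𝓝 (I / 2) := hUo.mem_nhds (by constructor <;> norm_num)
  have hpi : (Real.pi : ℂ) ≠ 0 := by exact_mod_cast Real.pi_pos.ne'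
  have hcosh : Differentiable ℂ fun y : ℂ => cosh (Real.pi * y) :=
    Complex.differentiable_cosh.comp (differentiable_id.const_mul _)
  have e0 : (Real.pi : ℂ) * (I / 2) = Real.pi / 2 * I := by ring
  have hcp : cosh (Real.pi * (I / 2)) = 0 := by
    rw [e0, Complex.cosh_mul_I, Complex.cos_pi_div_two]
  have hsp : sinh (Real.pi * (I / 2)) = I := by
    rw [e0, Complex.sinh_mul_I, Complex.sin_pi_div_two, one_mul]
  -- `D` is `cosh(πy) / (y - i/2)` with the singularity removed, and `g` below is `y - i/2` times
  -- the integrand. The slope of `g` at `i/2` is then the integrand minus its polar part.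
  set D : ℂ → ℂ := dslope (fun y : ℂ => cosh (Real.pi * y)) (I / 2) with hD
  have hDd : DifferentiableOn ℂ D U := (differentiableOn_dslope hU).2 hcosh.differentiableOn
  have hDp : D (I / 2) = Real.pi * I := by
    have h1 : HasDerivAt (fun y : ℂ => cosh (Real.pi * y))
        (sinh (Real.pi * (I / 2)) * (Real.pi * 1)) (I / 2) :=
      ((hasDerivAt_id (I / 2)).const_mul (Real.pi : ℂ)).ccosh
    rw [hD, dslope_same, h1.deriv, hsp]; ring
  have hDy : ∀ y, y ≠ I / 2 → D y = cosh (Real.pi * y) / (y - I / 2) := fun y hy => by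
    rw [hD, dslope_of_ne _ hy, slope_def_field, hcp, sub_zero]
  have hDne : ∀ y ∈ U, D y ≠ 0 := fun y hy => by
    by_cases h : y = I / 2
    · rw [h, hDp]; exact mul_ne_zero hpi I_ne_zero
    · rw [hDy y h]
      exact div_ne_zero (cosh_pi_mul_ne_zero_of_ne hy.1 hy.2 h) (sub_ne_zero.2 h)
  set g : ℂ → ℂ := fun y => exp (-Real.pi * t * y ^ 2 + 2 * Real.pi * t * ξ * y * I) *
    N (Real.pi * y) / D y with hg
  have hgd : DifferentiableOn ℂ g U := by
    refine DifferentiableOn.div (DifferentiableOn.mul (by fun_prop) ?_) hDd hDne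
    exact (hN.differentiable.comp (differentiable_id.const_mul _)).differentiableOn
  refine ⟨dslope g (I / 2), (differentiableOn_dslope hU).2 hgd, fun y hy => ?_⟩
  have hgp : g (I / 2) = Real.exp (Real.pi * t / 4 - Real.pi * t * ξ) * N (Real.pi * I / 2) /
      (Real.pi * I) := by
    simp only [hg, hDp]
    rw [ofReal_exp, mul_div_assoc (Real.pi : ℂ) I 2]
    congr 3
    push_cast
    linear_combination (-Real.pi * t / 4 + Real.pi * t * ξ) * I_sq
  rw [dslope_of_ne _ hy, slope_def_field, hgp, sub_div, ← div_eq_mul_inv]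
  congr 1
  simp only [hg, hDy y hy, integrand, kernel]
  rw [div_div, div_mul_cancel₀ _ (sub_ne_zero.2 hy), mul_div_assoc]

/-- By `integrand_add_I` the left side compares the integrals over `Im y = 0` and `Im y = 1`; the
right side is `2πi` times the residue at `i/2`. -/
lemma mordell_sub_mordell (hN : IsNumerator N κ) (ht : 0 < t) (ξ : ℝ) :
    mordell N t ξ - κ * Real.exp (Real.pi * t * (1 - 2 * ξ)) * mordell N t (ξ - 1) =
      2 * (Real.exp (Real.pi * t / 4 - Real.pi * t * ξ) * N (Real.pi * I / 2)) := by
  have hpi : (Real.pi : ℂ) ≠ 0 := by exact_mod_cast Real.pi_pos.ne'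
  have h0 : |(0 : ℝ)| < 1 / 2 := by norm_num
  obtain ⟨H, hHd, hH⟩ := exists_integrand_eq_residue_add hN t ξ
  set r : ℂ := Real.exp (Real.pi * t / 4 - Real.pi * t * ξ) * N (Real.pi * I / 2) / (Real.pi * I)
    with hr
  have hint : ∀ ξ : ℝ, Integrable fun x : ℝ => integrand N t ξ x := fun ξ => by
    simpa using integrable_integrand hN ht ξ h0
  have hint2 : Integrable fun x : ℝ =>
      κ * Real.exp (Real.pi * t * (1 - 2 * ξ)) * integrand N t (ξ - 1) x := (hint _).const_mul _
  have hsub : Integrable fun x : ℝ => integrand N t ξ x -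
      κ * Real.exp (Real.pi * t * (1 - 2 * ξ)) * integrand N t (ξ - 1) x := (hint ξ).sub hint2
  have hq : Integrable fun x : ℝ => r * (I * (((x ^ 2 + 1 / 4 : ℝ)⁻¹ : ℝ) : ℂ)) :=
    (integrable_inv_sq_add_quarter.ofReal.const_mul I).const_mul r
  have hdiff : ∀ x : ℝ, H (x + (0 : ℝ) * I) - H (x + (1 : ℝ) * I) =
      integrand N t ξ x - κ * Real.exp (Real.pi * t * (1 - 2 * ξ)) * integrand N t (ξ - 1) x -
        r * (I * (((x ^ 2 + 1 / 4 : ℝ)⁻¹ : ℝ) : ℂ)) := by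
    intro x
    have h1 : (x : ℂ) + (0 : ℝ) * I ≠ I / 2 := fun h => by
      have := congrArg im h; norm_num at this
    have h2 : (x : ℂ) + (1 : ℝ) * I ≠ I / 2 := fun h => by
      have := congrArg im h; norm_num at this
    rw [hH _ h1, hH _ h2, ← inv_sub_half_I_sub_inv_add_half_I, ← integrand_add_I hN]
    simp only [ofReal_zero, zero_mul, add_zero, ofReal_one, one_mul]
    rw [show (x : ℂ) + I - I / 2 = x + I / 2 by ring]
    ring
  have hHint : Integrable fun x : ℝ => H (x + (0 : ℝ) * I) - H (x + (1 : ℝ) * I) := by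
    simp_rw [hdiff]
    exact hsub.sub hq
  have key := integral_sub_eq_zero_of_strip (H := H) (c := 0) (d := 1)
    (hHd.mono fun z hz => ?_) (fun ε hε => ?_) hHint
  · simp_rw [hdiff] at key
    rw [integral_sub hsub hq, integral_sub (hint ξ) hint2, integral_const_mul,
      integral_const_mul, integral_const_mul, integral_complex_ofReal,
      integral_inv_sq_add_quarter] at key
    have e1 : r * (I * ((2 * Real.pi : ℝ) : ℂ)) =
        2 * (Real.exp (Real.pi * t / 4 - Real.pi * t * ξ) * N (Real.pi * I / 2)) := by
      rw [hr]; push_cast; field_simp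
    rw [mordell, mordell, ← e1]
    exact sub_eq_zero.1 key
  · have hz' : z.im ∈ Set.Icc (0 : ℝ) 1 := by simpa [Set.uIcc_of_le] using hz
    constructor
    · linarith [hz'.1]
    · linarith [hz'.2]
  · obtain ⟨R, hR1, hR⟩ := integrand_decay hN ht ξ 0 1 (half_pos hε)
    -- One half of `ε` is for the integrand, the other for the polar part, of norm at most `‖r‖ /
    -- |x|`.
    refine ⟨max R (2 * ‖r‖ / ε), fun x y hx hy => ?_⟩
    have hx1 : R ≤ |x| := (le_max_left _ _).trans hx
    have hx2 : 2 * ‖r‖ / ε ≤ |x| := (le_max_right _ _).trans hx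
    have hx0 : 0 < |x| := by linarith
    have hre : ((x : ℂ) + y * I - I / 2).re = x := by simp
    have hn : |x| ≤ ‖(x : ℂ) + y * I - I / 2‖ := by
      have := abs_re_le_norm ((x : ℂ) + y * I - I / 2)
      rwa [hre] at this
    have hne : (x : ℂ) + y * I ≠ I / 2 := fun h => by
      rw [h, sub_self, norm_zero] at hn
      linarith
    rw [hH _ hne]
    refine (norm_sub_le _ _).trans ?_
    have h1 : ‖r * ((x : ℂ) + y * I - I / 2)⁻¹‖ ≤ ε / 2 := by
      rw [norm_mul, norm_inv, ← div_eq_mul_inv, div_le_iff₀ (by linarith)]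
      rw [div_le_iff₀ hε] at hx2
      nlinarith
    linarith [hR x y hx1 hy]

/-- At `ξ = 1/2` the exponential factor is `1` and `ξ - 1 = -ξ`, so parity turns the left side of
the functional equation into twice the integral. -/
lemma mordell_half (hN : IsNumerator N κ) (ht : 0 < t) :
    mordell N t (1 / 2) = Real.exp (-(Real.pi * t / 4)) * N (Real.pi * I / 2) := by
  have h := mordell_sub_mordell hN ht (1 / 2)
  rw [show (1 / 2 - 1 : ℝ) = -(1 / 2) by norm_num, mordell_neg hN,
    show Real.pi * t * (1 - 2 * (1 / 2)) = 0 by ring, Real.exp_zero, ofReal_one,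
    show Real.pi * t / 4 - Real.pi * t * (1 / 2) = -(Real.pi * t / 4) by ring] at h
  linear_combination h / 2 - mordell N t (1 / 2) / 2 * hN.sq

lemma norm_numerator_le_one (hN : IsNumerator N κ) : ‖N (Real.pi * I / 2)‖ ≤ 1 := by
  have h := hN.norm_le (Real.pi * I / 2)
  have : ((Real.pi : ℂ) * I / 2).re = 0 := by simp
  rwa [this, Real.cosh_zero] at h

/-- In the induction, with `E` the target exponential, the residue contributes at most `2E` and the
previous integral at most `4E · e^{-πt(2k+1)} ≤ 2E`. This explains the constant `4`. -/
lemma norm_mordell_le (hN : IsNumerator N κ) (ht : 1 ≤ t) (k : ℕ) :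
    ‖mordell N t (k + 1 / 2)‖ ≤ 4 * Real.exp (-(Real.pi * t / 4) - Real.pi * t * k) := by
  have ht0 : 0 < t := by linarith
  have hν := norm_numerator_le_one hN
  induction k with
  | zero =>
    rw [Nat.cast_zero, zero_add, mordell_half hN ht0, norm_mul, Complex.norm_real,
      Real.norm_eq_abs, abs_of_pos (Real.exp_pos _), mul_zero, sub_zero]
    nlinarith [Real.exp_pos (-(Real.pi * t / 4))]
  | succ k ih =>
    have h := mordell_sub_mordell hN ht0 ((k + 1 : ℕ) + 1 / 2)
    rw [show (((k + 1 : ℕ) : ℝ) + 1 / 2 - 1) = k + 1 / 2 by push_cast; ring,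
      sub_eq_iff_eq_add] at h
    rw [h]
    refine (norm_add_le _ _).trans ?_
    rw [norm_mul, norm_mul, norm_mul, norm_mul, hN.norm_eq_one, Complex.norm_real,
      Complex.norm_real, Real.norm_eq_abs, Real.norm_eq_abs, abs_of_pos (Real.exp_pos _),
      abs_of_pos (Real.exp_pos _), Complex.norm_two, one_mul]
    set E := Real.exp (-(Real.pi * t / 4) - Real.pi * t * (k + 1 : ℕ)) with hE
    have e1 : Real.pi * t / 4 - Real.pi * t * ((k + 1 : ℕ) + 1 / 2) =
        -(Real.pi * t / 4) - Real.pi * t * (k + 1 : ℕ) := by ring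
    have e2 : Real.exp (Real.pi * t * (1 - 2 * ((k + 1 : ℕ) + 1 / 2))) *
        Real.exp (-(Real.pi * t / 4) - Real.pi * t * k) =
        E * Real.exp (-(Real.pi * t * (2 * k + 1))) := by
      rw [hE, ← Real.exp_add, ← Real.exp_add]; push_cast; ring_nf
    have e3 : Real.exp (-(Real.pi * t * (2 * k + 1))) ≤ 1 / 2 := by
      have h1 : 1 ≤ Real.pi * t * (2 * k + 1) := by
        have : 1 ≤ Real.pi * t := by nlinarith [Real.pi_gt_three]
        have : (0 : ℝ) ≤ k := Nat.cast_nonneg k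
        nlinarith
      have h2 := Real.add_one_le_exp (Real.pi * t * (2 * k + 1))
      rw [Real.exp_neg, one_div]
      exact inv_anti₀ two_pos (by linarith)
    have hEpos : 0 < E := Real.exp_pos _
    rw [e1]
    have h3 := mul_le_mul_of_nonneg_left ih
      (Real.exp_pos (Real.pi * t * (1 - 2 * ((k + 1 : ℕ) + 1 / 2)))).le
    have h4 := mul_le_mul_of_nonneg_left e3 hEpos.le
    have h5 := mul_le_mul_of_nonneg_left hν hEpos.le
    linarith

/-- Uniform bound for the Mordell integral at all half-integers. -/
lemma norm_mordell_int_le (hN : IsNumerator N κ) (ht : 1 ≤ t) (n : ℤ) :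
    ‖mordell N t (1 / 2 - n)‖ ≤
      4 * Real.exp (-(Real.pi * t / 4) - Real.pi * t * (|(n : ℝ) - 1 / 2| - 1 / 2)) := by
  rcases le_or_gt n 0 with hn | hn
  · obtain ⟨k, hk⟩ := Int.eq_ofNat_of_zero_le (neg_nonneg.2 hn)
    have hk' : (n : ℝ) = -k := by
      have : n = -(k : ℤ) := by rw [← hk, neg_neg]
      rw [this]; simp
    have h := norm_mordell_le hN ht k
    rw [hk', show (1 / 2 - -(k : ℝ)) = k + 1 / 2 by ring,
      show -(k : ℝ) - 1 / 2 = -(k + 1 / 2) by ring, abs_neg, abs_of_pos (by positivity),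
      add_sub_cancel_right]
    exact h
  · obtain ⟨k, hk⟩ := Int.eq_ofNat_of_zero_le (sub_nonneg.2 (Int.add_one_le_of_lt hn))
    have hk' : (n : ℝ) = k + 1 := by
      have : n = k + 1 := by rw [← hk]; ring
      rw [this]; simp
    have h := norm_mordell_le hN ht k
    rw [hk', show (1 / 2 - ((k : ℝ) + 1)) = -(k + 1 / 2) by ring, mordell_neg hN, norm_mul,
      norm_neg, hN.norm_eq_one, one_mul, show (k : ℝ) + 1 - 1 / 2 = k + 1 / 2 by ring,
      abs_of_pos (by positivity), add_sub_cancel_right]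
    exact h

end

/-! ### Poisson summation -/

section

variable {N : ℂ → ℂ} {κ : ℂ}

/-- The function whose values at the integers are summed. -/
def summand (N : ℂ → ℂ) (T : ℝ) (a : ℂ) (x : ℝ) : ℂ :=
  exp (Real.pi * I * x) * (exp (-Real.pi * T * (x + a) ^ 2) * kernel N (T * (x + a)))

lemma mul_add_eq (T : ℝ) (a : ℂ) (x : ℝ) :
    (T : ℂ) * (x + a) = ((T * x + T * a.re : ℝ) : ℂ) + ((T * a.im : ℝ) : ℂ) * I := by
  conv_lhs => rw [← re_add_im a]
  push_cast
  ring

lemma continuous_summand (hN : IsNumerator N κ) {T : ℝ} {a : ℂ} (h : |T * a.im| < 1 / 2) :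
    Continuous (summand N T a) := by
  unfold summand
  refine Continuous.mul (by fun_prop) (Continuous.mul (by fun_prop) ?_)
  simp_rw [mul_add_eq]
  exact (continuous_kernel_line hN h).comp (by fun_prop : Continuous fun x : ℝ => T * x + T * a.re)

lemma summand_isBigO (hN : IsNumerator N κ) {T : ℝ} (hT : 0 < T) {a : ℂ}
    (h : |T * a.im| < 1 / 2) :
    summand N T a =O[cocompact ℝ] fun x : ℝ => |x| ^ (-2 : ℝ) := by
  obtain ⟨C, hC⟩ := exists_norm_kernel_le hN h
  have h1 : (fun x : ℝ => exp (-Real.pi * T * x ^ 2 + (Real.pi * I - 2 * Real.pi * T * a) * x))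
      =O[cocompact ℝ] fun x : ℝ => |x| ^ (-2 : ℝ) :=
    (cexp_neg_quadratic_isLittleO_abs_rpow_cocompact (a := -Real.pi * T) (by
      have := mul_pos Real.pi_pos hT
      rw [neg_mul, ← ofReal_mul, neg_re, ofReal_re]
      linarith) (Real.pi * I - 2 * Real.pi * T * a) (-2)).isBigO
  have h2 : (fun x : ℝ => exp (-Real.pi * T * a ^ 2) * kernel N (T * (x + a)))
      =O[cocompact ℝ] fun _ : ℝ => (1 : ℝ) := by
    refine IsBigO.const_mul_left (IsBigO.of_bound C (Eventually.of_forall fun x => ?_)) _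
    rw [mul_add_eq, norm_one, mul_one]
    exact hC _
  have h3 := h1.mul h2
  simp only [mul_one] at h3
  refine h3.congr_left fun x => ?_
  rw [summand, ← mul_assoc, ← mul_assoc, ← Complex.exp_add, ← Complex.exp_add]
  congr 2
  ring

/-- Substitute `y = T(x + a)`: the line at height `T · Im a` is moved back to the real axis, and the
sign `e^{πix}` turns the frequency `n` into `ξ = 1/2 - n`. -/
lemma fourier_summand (hN : IsNumerator N κ) {T : ℝ} (hT : 0 < T) {a : ℂ}
    (h : |T * a.im| < 1 / 2) (n : ℤ) :
    𝓕 (summand N T a) n =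
      (T : ℂ)⁻¹ * (exp (2 * Real.pi * I * a * (n - 1 / 2)) * mordell N T⁻¹ (1 / 2 - n)) := by
  have hT' : (T : ℂ) ≠ 0 := by exact_mod_cast hT.ne'
  set F : ℝ → ℂ := fun x => integrand N T⁻¹ (1 / 2 - n) (x + ((T * a.im : ℝ) : ℂ) * I) with hF
  have e1 : ∀ x : ℝ, exp (((-2 * Real.pi * x * n : ℝ) : ℂ) * I) • summand N T a x =
      exp (2 * Real.pi * I * a * (n - 1 / 2)) * F (T * x + T * a.re) := by
    intro x
    simp only [hF]
    rw [← mul_add_eq, summand, integrand, smul_eq_mul, ← mul_assoc, ← mul_assoc, ← mul_assoc,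
      ← Complex.exp_add, ← Complex.exp_add, ← Complex.exp_add]
    congr 2
    push_cast
    field_simp
    ring
  rw [Real.fourier_real_eq_integral_exp_smul]
  simp_rw [e1]
  rw [integral_const_mul,
    Measure.integral_comp_mul_left (fun x => F (x + T * a.re)) T, integral_add_right_eq_self F,
    abs_of_pos (inv_pos.2 hT), hF, integral_integrand_line hN (inv_pos.2 hT) _ h,
    real_smul, ofReal_inv]
  ring

lemma neg_one_zpow_mul_coeff_mul_kernel (T : ℝ) (a : ℂ) (j : ℤ) :
    (-1 : ℂ) ^ j * (coeff T a j *
      (N (Real.pi * T * (j + a)) / cosh (Real.pi * T * (j + a)))) =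
      exp (Real.pi * T * a ^ 2) * summand N T a j := by
  rw [summand, kernel, coeff, neg_one_zpow_eq_exp, ← mul_assoc (Real.pi : ℂ), ofReal_intCast,
    ← mul_assoc, ← mul_assoc, ← mul_assoc, ← Complex.exp_add, ← Complex.exp_add,
    ← Complex.exp_add]
  congr 2
  ring

lemma abs_int_sub_half_ge (n : ℤ) : 1 / 2 ≤ |(n : ℝ) - 1 / 2| := by
  rcases le_or_gt n 0 with hn | hn
  · have : (n : ℝ) ≤ 0 := by exact_mod_cast hn
    rw [abs_of_nonpos (by linarith)]; linarith
  · have : (1 : ℝ) ≤ n := by exact_mod_cast hn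
    rw [abs_of_nonneg (by linarith)]; linarith

lemma abs_int_sub_half_ge_of_ne {n : ℤ} (h0 : n ≠ 0) (h1 : n ≠ 1) :
    3 / 2 ≤ |(n : ℝ) - 1 / 2| := by
  rcases le_or_gt n 0 with hn | hn
  · have : (n : ℝ) ≤ -1 := by exact_mod_cast (by omega : n ≤ -1)
    rw [abs_of_nonpos (by linarith)]; linarith
  · have : (2 : ℝ) ≤ n := by exact_mod_cast (by omega : 2 ≤ n)
    rw [abs_of_nonneg (by linarith)]; linarith

/-- The exponential in `a` grows at most like `e^{2π‖a‖|n - 1/2|}`, which lowers the decay rate from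
`t` to `t - 2‖a‖`. -/
lemma norm_dual_term_le (hN : IsNumerator N κ) {t : ℝ} (ht : 1 ≤ t) (a : ℂ) (n : ℤ) :
    ‖(Real.exp (Real.pi * t / 4) : ℂ) *
        (exp (2 * Real.pi * I * a * (n - 1 / 2)) * mordell N t (1 / 2 - n))‖ ≤
      4 * Real.exp (Real.pi * ‖a‖) *
        Real.exp (-(Real.pi * (t - 2 * ‖a‖)) * (|(n : ℝ) - 1 / 2| - 1 / 2)) := by
  rw [norm_mul, norm_mul, Complex.norm_real, Real.norm_eq_abs, abs_of_pos (Real.exp_pos _),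
    Complex.norm_exp]
  have e1 : (2 * Real.pi * I * a * (n - 1 / 2)).re = -(2 * Real.pi * a.im * (n - 1 / 2)) := by
    rw [← re_two_pi_I_mul]; push_cast; rfl
  have h1 : Real.exp (2 * Real.pi * I * a * (n - 1 / 2)).re ≤
      Real.exp (2 * Real.pi * ‖a‖ * |(n : ℝ) - 1 / 2|) := by
    rw [e1]; exact Real.exp_le_exp.2 (neg_im_mul_le a _)
  have h2 := norm_mordell_int_le hN ht n
  calc _ ≤ Real.exp (Real.pi * t / 4) * (Real.exp (2 * Real.pi * ‖a‖ * |(n : ℝ) - 1 / 2|) *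
        (4 * Real.exp (-(Real.pi * t / 4) - Real.pi * t * (|(n : ℝ) - 1 / 2| - 1 / 2)))) := by
        gcongr
    _ = 4 * (Real.exp (Real.pi * t / 4) * (Real.exp (2 * Real.pi * ‖a‖ * |(n : ℝ) - 1 / 2|) *
        (Real.exp (-(Real.pi * t / 4) - Real.pi * t * (|(n : ℝ) - 1 / 2| - 1 / 2))))) := by ring
    _ = _ := by
      rw [mul_assoc 4 (Real.exp (Real.pi * ‖a‖)), ← Real.exp_add, ← Real.exp_add, ← Real.exp_add]
      ring_nf

lemma summable_exp_neg_pi_abs :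
    Summable fun n : ℤ => Real.exp (-Real.pi * (|(n : ℝ) - 1 / 2| - 1 / 2)) := by
  have h : Summable fun n : ℕ => Real.exp (n * (-Real.pi)) :=
    Real.summable_exp_nat_mul_iff.2 (neg_lt_zero.2 Real.pi_pos)
  have h' : ∀ n : ℕ, |(n : ℝ)| = n := fun n => abs_of_nonneg (Nat.cast_nonneg n)
  have h2 : Summable fun n : ℤ => Real.exp (-Real.pi * |(n : ℝ)|) := by
    refine Summable.of_nat_of_neg (h.congr fun n => ?_) (h.congr fun n => ?_)
    · rw [Int.cast_natCast, h', mul_comm]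
    · rw [Int.cast_neg, Int.cast_natCast, abs_neg, h', mul_comm]
  refine Summable.of_nonneg_of_le (fun _ => (Real.exp_pos _).le) (fun n => ?_)
    (h2.mul_right (Real.exp Real.pi))
  rw [← Real.exp_add]
  refine Real.exp_le_exp.2 ?_
  have h3 : |(n : ℝ)| ≤ |(n : ℝ) - 1 / 2| + 1 / 2 := by
    have := abs_add_le ((n : ℝ) - 1 / 2) (1 / 2)
    rwa [sub_add_cancel, abs_of_pos (one_half_pos (α := ℝ))] at this
  nlinarith [Real.pi_pos]

lemma norm_dual_term_le_of_le (hN : IsNumerator N κ) {t : ℝ} {a : ℂ} (ht : 1 + 2 * ‖a‖ ≤ t)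
    (n : ℤ) :
    ‖(Real.exp (Real.pi * t / 4) : ℂ) *
        (exp (2 * Real.pi * I * a * (n - 1 / 2)) * mordell N t (1 / 2 - n))‖ ≤
      4 * Real.exp (Real.pi * ‖a‖) * Real.exp (-Real.pi * (|(n : ℝ) - 1 / 2| - 1 / 2)) := by
  refine (norm_dual_term_le hN (by linarith [norm_nonneg a]) a n).trans ?_
  refine mul_le_mul_of_nonneg_left (Real.exp_le_exp.2 ?_) (by positivity)
  refine mul_le_mul_of_nonneg_right ?_ (sub_nonneg.2 (abs_int_sub_half_ge n))
  nlinarith [Real.pi_pos]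

/-- For `n = 0, 1`, that is `ξ = ±1/2`, the normalised terms do not depend on `t > 0`; all others
decay exponentially. -/
lemma tendsto_tsum_dual (hN : IsNumerator N κ) (a : ℂ) :
    Tendsto (fun t : ℝ => ∑' n : ℤ, (Real.exp (Real.pi * t / 4) : ℂ) *
        (exp (2 * Real.pi * I * a * (n - 1 / 2)) * mordell N t (1 / 2 - n))) atTop
      (𝓝 (N (Real.pi * I / 2) * (exp (-(a * Real.pi * I)) - κ * exp (a * Real.pi * I)))) := by
  have hval : ∀ t : ℝ, 0 < t → (Real.exp (Real.pi * t / 4) : ℂ) * mordell N t (1 / 2) =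
      N (Real.pi * I / 2) := fun t ht => by
    rw [mordell_half hN ht, ← mul_assoc, ← ofReal_mul, ← Real.exp_add, add_neg_cancel,
      Real.exp_zero, ofReal_one, one_mul]
  set g : ℤ → ℂ := fun n => if n = 0 then N (Real.pi * I / 2) * exp (-(a * Real.pi * I)) else
    if n = 1 then -(N (Real.pi * I / 2) * (κ * exp (a * Real.pi * I))) else 0 with hg
  have hsum : ∑' n, g n =
      N (Real.pi * I / 2) * (exp (-(a * Real.pi * I)) - κ * exp (a * Real.pi * I)) := by
    rw [tsum_eq_sum (s := {0, 1}) fun n hn => by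
      simp only [Finset.mem_insert, Finset.mem_singleton, not_or] at hn
      simp [hg, hn.1, hn.2], Finset.sum_pair zero_ne_one]
    simp only [hg, if_true, one_ne_zero, if_false]
    ring
  rw [← hsum]
  refine tendsto_tsum_of_dominated_convergence
    (summable_exp_neg_pi_abs.mul_left (4 * Real.exp (Real.pi * ‖a‖))) (fun n => ?_) ?_
  · simp only [hg]
    split_ifs with h0 h1
    · refine tendsto_const_nhds.congr' ?_
      filter_upwards [eventually_gt_atTop 0] with t ht
      rw [← hval t ht, h0, Int.cast_zero, Int.cast_zero, sub_zero,
        show 2 * Real.pi * I * a * (0 - 1 / 2) = -(a * Real.pi * I) by ring]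
      ring
    · refine tendsto_const_nhds.congr' ?_
      filter_upwards [eventually_gt_atTop 0] with t ht
      rw [← hval t ht, h1, Int.cast_one, Int.cast_one,
        show (1 / 2 - 1 : ℝ) = -(1 / 2) by norm_num, mordell_neg hN,
        show 2 * Real.pi * I * a * (1 - 1 / 2) = a * Real.pi * I by ring]
      ring
    · refine squeeze_zero_norm' (a := fun t : ℝ => 4 * Real.exp (Real.pi * ‖a‖) *
        Real.exp (-(Real.pi * (t - 2 * ‖a‖)) * (|(n : ℝ) - 1 / 2| - 1 / 2))) ?_ ?_
      · filter_upwards [eventually_ge_atTop 1] with t ht using norm_dual_term_le hN ht a n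
      · have hpos : 0 < |(n : ℝ) - 1 / 2| - 1 / 2 := by
          linarith [abs_int_sub_half_ge_of_ne h0 h1]
        have h2 : Tendsto (fun t : ℝ => -(Real.pi * (t - 2 * ‖a‖)) *
            (|(n : ℝ) - 1 / 2| - 1 / 2)) atTop atBot := by
          have h3 : Tendsto (fun t : ℝ => t - 2 * ‖a‖) atTop atTop :=
            tendsto_atTop_add_const_right _ _ tendsto_id
          exact (tendsto_neg_atTop_atBot.comp (h3.const_mul_atTop Real.pi_pos)).atBot_mul_const hpos
        simpa using (Real.tendsto_exp_atBot.comp h2).const_mul (4 * Real.exp (Real.pi * ‖a‖))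
  · filter_upwards [eventually_ge_atTop (1 + 2 * ‖a‖)] with t ht n
    exact norm_dual_term_le_of_le hN ht n

/-- Poisson summation. The factor `e^{πTa²}` comes from completing the square in `coeff`; the
condition on `T⁻¹` makes the dual series summable. -/
lemma mul_tsum_eq_tsum_dual (hN : IsNumerator N κ) {T : ℝ} (hT : 0 < T) {a : ℂ}
    (h : |T * a.im| < 1 / 2) (ht : 1 + 2 * ‖a‖ ≤ T⁻¹) :
    (T : ℂ) * exp (Real.pi / (4 * T)) * ∑' j : ℤ, (-1 : ℂ) ^ j * (coeff T a j *
      (N (Real.pi * T * (j + a)) / cosh (Real.pi * T * (j + a)))) =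
      exp (Real.pi * T * a ^ 2) * ∑' n : ℤ, (Real.exp (Real.pi * T⁻¹ / 4) : ℂ) *
        (exp (2 * Real.pi * I * a * (n - 1 / 2)) * mordell N T⁻¹ (1 / 2 - n)) := by
  have hT' : (T : ℂ) ≠ 0 := by exact_mod_cast hT.ne'
  have hs : Summable fun n : ℤ => (Real.exp (Real.pi * T⁻¹ / 4) : ℂ) *
        (exp (2 * Real.pi * I * a * (n - 1 / 2)) * mordell N T⁻¹ (1 / 2 - n)) :=
    Summable.of_norm_bounded (summable_exp_neg_pi_abs.mul_left (4 * Real.exp (Real.pi * ‖a‖)))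
      fun n => norm_dual_term_le_of_le hN ht n
  have hE : (Real.exp (Real.pi * T⁻¹ / 4) : ℂ) ≠ 0 := by
    exact_mod_cast (Real.exp_pos _).ne'
  have hE' : exp (Real.pi / (4 * T)) = (Real.exp (Real.pi * T⁻¹ / 4) : ℂ) := by
    rw [ofReal_exp]; congr 1; push_cast; field_simp
  have hFs : Summable fun n : ℤ => 𝓕 (summand N T a) n := by
    refine (hs.mul_left ((T : ℂ)⁻¹ * (Real.exp (Real.pi * T⁻¹ / 4) : ℂ)⁻¹)).congr fun n => ?_
    rw [fourier_summand hN hT h]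
    field_simp
  have hP := Real.tsum_eq_tsum_fourier_of_rpow_decay_of_summable (continuous_summand hN h)
    one_lt_two (summand_isBigO hN hT h) hFs 0
  simp only [zero_add] at hP
  simp_rw [neg_one_zpow_mul_coeff_mul_kernel]
  rw [tsum_mul_left, hP, tsum_mul_left, hE']
  have e1 : ∑' n : ℤ, 𝓕 (summand N T a) n * fourier n ((0 : ℝ) : UnitAddCircle) =
      (T : ℂ)⁻¹ * ∑' n : ℤ, (exp (2 * Real.pi * I * a * (n - 1 / 2)) *
        mordell N T⁻¹ (1 / 2 - n)) := by
    rw [← tsum_mul_left]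
    refine tsum_congr fun n => ?_
    rw [fourier_summand hN hT h]
    simp
  rw [e1]
  field_simp

theorem tendsto_mul_tsum_kernel (hN : IsNumerator N κ) (a : ℂ) :
    Tendsto (fun T : ℝ => (T : ℂ) * exp (Real.pi / (4 * T)) *
      ∑' j : ℤ, (-1 : ℂ) ^ j * (coeff T a j *
        (N (Real.pi * T * (j + a)) / cosh (Real.pi * T * (j + a))))) (𝓝[>] 0)
      (𝓝 (N (Real.pi * I / 2) * (exp (-(a * Real.pi * I)) - κ * exp (a * Real.pi * I)))) := by
  have h1 : Tendsto (fun T : ℝ => exp (Real.pi * T * a ^ 2)) (𝓝[>] 0) (𝓝 1) := by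
    have : Continuous fun T : ℝ => exp (Real.pi * T * a ^ 2) := by fun_prop
    simpa using (this.tendsto 0).mono_left (nhdsWithin_le_nhds (s := Set.Ioi 0))
  have h2 := h1.mul ((tendsto_tsum_dual hN a).comp tendsto_inv_nhdsGT_zero)
  rw [one_mul] at h2
  refine h2.congr' ?_
  have h3 : ∀ᶠ T : ℝ in 𝓝[>] 0, 1 + 2 * ‖a‖ ≤ T⁻¹ :=
    tendsto_inv_nhdsGT_zero.eventually (eventually_ge_atTop _)
  filter_upwards [self_mem_nhdsWithin, h3, eventually_mul_abs_le_one a.im] with T hT ht him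
  refine (mul_tsum_eq_tsum_dual hN hT ?_ ht).symm
  rw [mul_assoc, abs_mul, abs_of_pos Real.pi_pos] at him
  nlinarith [Real.pi_gt_three, abs_nonneg (T * a.im)]

end

/-! ### Alternating sums with denominator `cosh` -/

lemma summable_neg_one_zpow_mul {f : ℤ → ℂ} (hf : Summable f) :
    Summable fun j : ℤ => (-1 : ℂ) ^ j * f j :=
  Summable.of_norm_bounded hf.norm fun j => by simp [norm_zpow]

lemma summable_coeff_mul_inv_cosh {T : ℝ} (hT : 0 < T) {a : ℂ} (h : |Real.pi * T * a.im| ≤ 1) :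
    Summable fun j : ℤ => coeff T a j * (1 / cosh (Real.pi * T * (j + a))) := by
  have h' : |T * a.im| < 1 / 2 := by
    rw [mul_assoc, abs_mul, abs_of_pos Real.pi_pos] at h
    nlinarith [Real.pi_gt_three, abs_nonneg (T * a.im)]
  obtain ⟨C, hC⟩ := exists_norm_kernel_le isNumerator_one h'
  refine summable_coeff_mul hT a (B := C) (K := 0) fun j => ?_
  have := hC (T * j + T * a.re)
  rw [← mul_add_eq, kernel, ← mul_assoc, ofReal_intCast] at this
  simpa using this

lemma tendsto_mul_tsum_exp_div_cosh (a : ℂ) :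
    Tendsto (fun T : ℝ => (T : ℂ) * exp (Real.pi / (4 * T)) *
      ∑' j : ℤ, (-1 : ℂ) ^ j * (coeff T a j *
        (exp (Real.pi * T * (j + a)) / (2 * cosh (Real.pi * T * (j + a)))))) (𝓝[>] 0)
      (𝓝 (sin (a * Real.pi))) := by
  have h := ((tendsto_exp_mul_tsum_neg_one_zpow_mul_coeff a).add
    (tendsto_mul_tsum_kernel isNumerator_sinh a)).div_const 2
  -- The theta part contributes `0`, and `sinh(πi/2) = i` turns the difference of exponentials into
  -- `2 sin(πa)`.
  have e1 : (0 + sinh (Real.pi * I / 2) *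
      (exp (-(a * Real.pi * I)) - 1 * exp (a * Real.pi * I))) / 2 = sin (a * Real.pi) := by
    rw [show (Real.pi : ℂ) * I / 2 = Real.pi / 2 * I by ring, Complex.sinh_mul_I,
      Complex.sin_pi_div_two, Complex.sin, neg_mul]
    ring
  rw [e1] at h
  refine h.congr' ?_
  filter_upwards [self_mem_nhdsWithin, eventually_mul_abs_le_one a.im] with T hT him
  rw [← mul_add, ← (summable_neg_one_zpow_mul (summable_coeff hT a)).tsum_add
    (summable_neg_one_zpow_mul (summable_coeff_mul_tanh hT him)), mul_div_assoc, ← tsum_div_const]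
  congr 1
  refine tsum_congr fun j => ?_
  rw [exp_div_two_cosh (cosh_pi_mul_ne_zero him j)]
  ring

/-- Makes the `e^w` part of `g₂` an alternating theta series with parameter `a - 1/2`, negligible at
the scale of the main term. -/
lemma coeff_mul_exp (T : ℝ) (a : ℂ) (j : ℤ) :
    coeff T a j * exp (Real.pi * T * (j + a)) =
      exp (Real.pi * T * a) * coeff T (a - 1 / 2) j := by
  rw [coeff, coeff, ← Complex.exp_add, ← Complex.exp_add]
  congr 1
  ring

lemma tendsto_exp_const_mul (c : ℂ) :
    Tendsto (fun T : ℝ => exp (Real.pi * T * c)) (𝓝[>] 0) (𝓝 1) := by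
  have : Continuous fun T : ℝ => exp (Real.pi * T * c) := by fun_prop
  simpa using (this.tendsto 0).mono_left (nhdsWithin_le_nhds (s := Set.Ioi 0))

lemma tendsto_mul_tsum_exp_two_mul_div_cosh (a : ℂ) :
    Tendsto (fun T : ℝ => (T : ℂ) * exp (Real.pi / (4 * T)) *
      ∑' j : ℤ, (-1 : ℂ) ^ j * (coeff T a j *
        (exp (2 * (Real.pi * T * (j + a))) / (2 * cosh (Real.pi * T * (j + a)))))) (𝓝[>] 0)
      (𝓝 (-cos (a * Real.pi))) := by
  have h := ((tendsto_exp_const_mul a).mul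
    (tendsto_exp_mul_tsum_neg_one_zpow_mul_coeff (a - 1 / 2))).sub
    ((tendsto_mul_tsum_kernel isNumerator_one a).div_const 2)
  have e1 : 1 * 0 - 1 * (exp (-(a * Real.pi * I)) - -1 * exp (a * Real.pi * I)) / 2 =
      -cos (a * Real.pi) := by
    simp only [Complex.cos, neg_mul]
    ring
  rw [e1] at h
  refine h.congr' ?_
  filter_upwards [self_mem_nhdsWithin, eventually_mul_abs_le_one a.im] with T hT him
  rw [mul_left_comm, mul_div_assoc, ← mul_sub, ← tsum_mul_left, ← tsum_div_const,
    ← ((summable_neg_one_zpow_mul (summable_coeff hT (a - 1 / 2))).mul_left _).tsum_sub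
      ((summable_neg_one_zpow_mul (summable_coeff_mul_inv_cosh hT him)).div_const 2)]
  congr 1
  refine tsum_congr fun j => ?_
  rw [exp_two_mul_div_two_cosh (cosh_pi_mul_ne_zero him j), mul_sub (coeff T a j), coeff_mul_exp]
  ring

/-! ### The functions at `τ = iT`, `z = aτ` -/

lemma e_mul_qPow (T : ℝ) (a x : ℂ) :
    e (a * (I * T)) * qPow (I * T) x = exp (-(2 * (Real.pi * T * (x + a)))) := by
  rw [e, qPow, ← Complex.exp_add]
  congr 1
  linear_combination (2 * Real.pi * T * (x + a)) * I_sq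

/-- No condition on `w` is needed: if the denominator vanishes, so does `sinh w`, and both quotients
are `0`. -/
lemma div_one_sub_exp (x w : ℂ) :
    x / (1 - exp (-(2 * w))) = x * (exp w / (2 * sinh w)) := by
  have h : 1 - exp (-(2 * w)) = 2 * sinh w * exp (-w) := by
    have h1 : exp w * exp (-w) = 1 := by rw [← Complex.exp_add]; simp
    have h2 : exp (-(2 * w)) = exp (-w) * exp (-w) := by rw [← Complex.exp_add]; ring_nf
    rw [Complex.sinh, h2]
    linear_combination -h1
  rw [h, Complex.exp_neg, div_eq_mul_inv, mul_inv, inv_inv]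
  ring

lemma div_one_add_exp (x w : ℂ) :
    x / (1 + exp (-(2 * w))) = x * (exp w / (2 * cosh w)) := by
  have h : 1 + exp (-(2 * w)) = 2 * cosh w * exp (-w) := by
    have h1 : exp w * exp (-w) = 1 := by rw [← Complex.exp_add]; simp
    have h2 : exp (-(2 * w)) = exp (-w) * exp (-w) := by rw [← Complex.exp_add]; ring_nf
    rw [Complex.cosh, h2]
    linear_combination -h1
  rw [h, Complex.exp_neg, div_eq_mul_inv, mul_inv, inv_inv]
  ring

lemma exp_two_mul_div (w d : ℂ) : exp (2 * w) / d = exp w * (exp w / d) := by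
  rw [two_mul, Complex.exp_add, mul_div_assoc]

lemma numerator_int (T : ℝ) (a : ℂ) (j : ℤ) :
    e (j * (a * (I * T))) * qPow (I * T) (1 / 2 * (j : ℂ) ^ 2) = coeff T a j := by
  rw [e, qPow, coeff, ← Complex.exp_add]
  congr 1
  linear_combination (Real.pi * T * ((j : ℂ) ^ 2 + 2 * j * a)) * I_sq

/-- From `(j + 1/2)² + 2(j + 1/2)a = j² + 2j(a + 1/2) + (a + 1/4)`. -/
lemma numerator_half (T : ℝ) (a : ℂ) (j : ℤ) :
    e ((j + 1 / 2) * (a * (I * T))) * qPow (I * T) (1 / 2 * ((j : ℂ) + 1 / 2) ^ 2) =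
      exp (Real.pi * T * -(a + 1 / 4)) * coeff T (a + 1 / 2) j := by
  rw [e, qPow, coeff, ← Complex.exp_add, ← Complex.exp_add]
  congr 1
  linear_combination (Real.pi * T * (((j : ℂ) + 1 / 2) ^ 2 + 2 * (j + 1 / 2) * a)) * I_sq

lemma numerator_int' (T : ℝ) (a : ℂ) (j : ℤ) :
    e ((j - 1 / 2) * (a * (I * T))) * qPow (I * T) (1 / 2 * j * (j - 1)) =
      coeff T a j * exp (Real.pi * T * (j + a)) := by
  rw [e, qPow, coeff, ← Complex.exp_add, ← Complex.exp_add]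
  congr 1
  linear_combination (Real.pi * T * ((j : ℂ) ^ 2 - j + 2 * (j - 1 / 2) * a)) * I_sq

lemma numerator_half' (T : ℝ) (a : ℂ) (j : ℤ) :
    e (j * (a * (I * T))) * qPow (I * T) (1 / 2 * ((j : ℂ) ^ 2 - 1 / 4)) =
      exp (Real.pi * T * -(a + 1 / 4)) *
        (coeff T (a + 1 / 2) j * exp (Real.pi * T * (j + (a + 1 / 2)))) := by
  rw [e, qPow, coeff, ← Complex.exp_add, ← Complex.exp_add, ← Complex.exp_add]
  congr 1
  linear_combination (Real.pi * T * ((j : ℂ) ^ 2 - 1 / 4 + 2 * j * a)) * I_sq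

lemma half_add_eq (j : ℤ) (a : ℂ) : (j : ℂ) + 1 / 2 + a = j + (a + 1 / 2) := by ring

lemma f₁_eq (T : ℝ) (a : ℂ) : f₁ (I * T) (a * (I * T)) = ∑' j : ℤ, coeff T a j *
    (exp (Real.pi * T * (j + a)) / (2 * sinh (Real.pi * T * (j + a)))) :=
  tsum_congr fun j => by rw [e_mul_qPow, div_one_sub_exp, numerator_int]

lemma h₁_eq (T : ℝ) (a : ℂ) : h₁ (I * T) (a * (I * T)) = ∑' j : ℤ, (-1 : ℂ) ^ j * (coeff T a j *
    (exp (Real.pi * T * (j + a)) / (2 * sinh (Real.pi * T * (j + a))))) :=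
  tsum_congr fun j => by rw [e_mul_qPow, div_one_sub_exp, numerator_int]

lemma g₁_eq (T : ℝ) (a : ℂ) : g₁ (I * T) (a * (I * T)) = ∑' j : ℤ, coeff T a j *
    (exp (2 * (Real.pi * T * (j + a))) / (2 * sinh (Real.pi * T * (j + a)))) :=
  tsum_congr fun j => by
    rw [e_mul_qPow, div_one_sub_exp, numerator_int', exp_two_mul_div, mul_assoc]

lemma f₃_eq (T : ℝ) (a : ℂ) : f₃ (I * T) (a * (I * T)) = ∑' j : ℤ, (-1 : ℂ) ^ j * (coeff T a j *
    (exp (Real.pi * T * (j + a)) / (2 * cosh (Real.pi * T * (j + a))))) :=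
  tsum_congr fun j => by rw [e_mul_qPow, div_one_add_exp, numerator_int]

lemma h₃_eq (T : ℝ) (a : ℂ) : h₃ (I * T) (a * (I * T)) = ∑' j : ℤ, coeff T a j *
    (exp (Real.pi * T * (j + a)) / (2 * cosh (Real.pi * T * (j + a)))) :=
  tsum_congr fun j => by rw [e_mul_qPow, div_one_add_exp, numerator_int]

lemma g₂_eq (T : ℝ) (a : ℂ) : g₂ (I * T) (a * (I * T)) = ∑' j : ℤ, (-1 : ℂ) ^ j * (coeff T a j *
    (exp (2 * (Real.pi * T * (j + a))) / (2 * cosh (Real.pi * T * (j + a))))) :=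
  tsum_congr fun j => by
    rw [e_mul_qPow, div_one_add_exp, numerator_int', exp_two_mul_div, mul_assoc]

lemma f₄_eq (T : ℝ) (a : ℂ) : f₄ (I * T) (a * (I * T)) =
    exp (Real.pi * T * -(a + 1 / 4)) * f₁ (I * T) ((a + 1 / 2) * (I * T)) := by
  rw [f₁_eq, ← tsum_mul_left]
  exact tsum_congr fun j => by
    rw [e_mul_qPow, div_one_sub_exp, numerator_half, half_add_eq, mul_assoc]

lemma h₂_eq (T : ℝ) (a : ℂ) : h₂ (I * T) (a * (I * T)) =
    exp (Real.pi * T * -(a + 1 / 4)) * h₁ (I * T) ((a + 1 / 2) * (I * T)) := by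
  rw [h₁_eq, ← tsum_mul_left]
  exact tsum_congr fun j => by
    rw [e_mul_qPow, div_one_sub_exp, numerator_half, half_add_eq, mul_assoc, mul_left_comm]

lemma g₃_eq (T : ℝ) (a : ℂ) : g₃ (I * T) (a * (I * T)) =
    exp (Real.pi * T * -(a + 1 / 4)) * g₁ (I * T) ((a + 1 / 2) * (I * T)) := by
  rw [g₁_eq, ← tsum_mul_left]
  exact tsum_congr fun j => by
    rw [e_mul_qPow, div_one_sub_exp, numerator_half', half_add_eq, exp_two_mul_div]
    ring

lemma f₂_eq (T : ℝ) (a : ℂ) : f₂ (I * T) (a * (I * T)) =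
    exp (Real.pi * T * -(a + 1 / 4)) * f₃ (I * T) ((a + 1 / 2) * (I * T)) := by
  rw [f₃_eq, ← tsum_mul_left]
  exact tsum_congr fun j => by
    rw [e_mul_qPow, div_one_add_exp, numerator_half, half_add_eq, mul_assoc, mul_left_comm]

lemma h₄_eq (T : ℝ) (a : ℂ) : h₄ (I * T) (a * (I * T)) =
    exp (Real.pi * T * -(a + 1 / 4)) * h₃ (I * T) ((a + 1 / 2) * (I * T)) := by
  rw [h₃_eq, ← tsum_mul_left]
  exact tsum_congr fun j => by
    rw [e_mul_qPow, div_one_add_exp, numerator_half, half_add_eq, mul_assoc]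

lemma g₄_eq (T : ℝ) (a : ℂ) : g₄ (I * T) (a * (I * T)) =
    exp (Real.pi * T * -(a + 1 / 4)) * g₂ (I * T) ((a + 1 / 2) * (I * T)) := by
  rw [g₂_eq, ← tsum_mul_left]
  exact tsum_congr fun j => by
    rw [e_mul_qPow, div_one_add_exp, numerator_half', half_add_eq, exp_two_mul_div]
    ring

/-! ### Leading asymptotics -/

lemma leadingAsymptotics_of_tendsto {F φ : ℂ → ℂ} {C : ℂ}
    (h : Tendsto (fun T : ℝ => F (I * T) / φ (I * T)) (𝓝[>] 0) (𝓝 C)) :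
    LeadingAsymptotics F C φ := by
  have h1 : Tendsto (fun τ => F τ / φ τ) downZero (𝓝 C) := tendsto_map'_iff.2 h
  refine ⟨h1, fun hC => ?_⟩
  refine isEquivalent_of_tendsto_one ?_
  have h2 := h1.div_const C
  rw [div_self hC] at h2
  refine h2.congr fun τ => ?_
  rw [Pi.div_apply, div_div, mul_comm C]

lemma neg_I_mul (T : ℝ) : -I * (I * T) = (T : ℂ) := by linear_combination (-(T : ℂ)) * I_sq

lemma leadingAsymptotics_inv {F : ℂ → ℂ} {C : ℂ}
    (h : Tendsto (fun T : ℝ => (T : ℂ) * F (I * T)) (𝓝[>] 0) (𝓝 C)) :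
    LeadingAsymptotics F C fun τ => (-I * τ)⁻¹ := by
  refine leadingAsymptotics_of_tendsto (h.congr fun T => ?_)
  rw [neg_I_mul, div_inv_eq_mul, mul_comm]

lemma neg_pi_mul_I_div (T : ℝ) :
    -((Real.pi : ℂ) * I) / (4 * (I * T)) = -(Real.pi / (4 * T)) := by
  rw [neg_div, mul_left_comm, mul_comm (Real.pi : ℂ), mul_div_mul_left _ _ I_ne_zero]

lemma leadingAsymptotics_inv_mul_exp {F : ℂ → ℂ} {C : ℂ}
    (h : Tendsto (fun T : ℝ => (T : ℂ) * exp (Real.pi / (4 * T)) * F (I * T)) (𝓝[>] 0) (𝓝 C)) :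
    LeadingAsymptotics F C fun τ => (-I * τ)⁻¹ * exp (-(Real.pi * I) / (4 * τ)) := by
  refine leadingAsymptotics_of_tendsto (h.congr fun T => ?_)
  rw [neg_I_mul, neg_pi_mul_I_div, Complex.exp_neg, ← mul_inv, div_inv_eq_mul, mul_comm]

lemma leadingAsymptotics_cpow {F : ℂ → ℂ} {C : ℂ}
    (h : Tendsto (fun T : ℝ => (√T : ℂ) * F (I * T)) (𝓝[>] 0) (𝓝 C)) :
    LeadingAsymptotics F C fun τ => (-I * τ) ^ (-(1 / 2) : ℂ) := by
  have e1 : ∀ T : ℝ, 0 < T → (-I * (I * T)) ^ (-(1 / 2) : ℂ) = ((√T : ℝ) : ℂ)⁻¹ := fun T hT => by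
    rw [neg_I_mul, Complex.cpow_neg, ofReal_cpow_half hT]
  refine leadingAsymptotics_of_tendsto (h.congr' ?_)
  filter_upwards [self_mem_nhdsWithin] with T hT
  rw [e1 T hT, div_inv_eq_mul, mul_comm]

/-- Multiplication by a factor tending to `1`. -/
lemma tendsto_mul_exp_mul {A F G : ℝ → ℂ} {c C : ℂ}
    (hF : ∀ T, F T = exp (Real.pi * T * c) * G T)
    (h : Tendsto (fun T => A T * G T) (𝓝[>] 0) (𝓝 C)) :
    Tendsto (fun T => A T * F T) (𝓝[>] 0) (𝓝 C) := by
  have h1 := (tendsto_exp_const_mul c).mul h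
  rw [one_mul] at h1
  exact h1.congr fun T => by rw [hF, mul_left_comm]

lemma pi_mul_cot_div (a : ℂ) :
    (Real.pi * cot (Real.pi * a)) / (2 * Real.pi) = 1 / 2 * cot (a * Real.pi) := by
  have hpi : (Real.pi : ℂ) ≠ 0 := by exact_mod_cast Real.pi_pos.ne'
  rw [mul_comm (Real.pi : ℂ) a]
  field_simp

lemma tendsto_f₁ {a : ℂ} (ha : sin (a * Real.pi) ≠ 0) :
    Tendsto (fun T : ℝ => (T : ℂ) * f₁ (I * T) (a * (I * T))) (𝓝[>] 0)
      (𝓝 (1 / 2 * cot (a * Real.pi))) := by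
  have hm := mem_integerComplement_of_sin_ne_zero ha
  have h := tendsto_mul_tsum_exp_div_sinh hm 1 (ε := fun _ => 1) (by simp)
    (by simpa only [one_mul] using tendsto_tsum_coeff_mul_inv_add hm)
  rw [pi_mul_cot_div] at h
  simpa only [one_mul, Nat.cast_one, f₁_eq] using h

lemma tendsto_g₁ {a : ℂ} (ha : sin (a * Real.pi) ≠ 0) :
    Tendsto (fun T : ℝ => (T : ℂ) * g₁ (I * T) (a * (I * T))) (𝓝[>] 0)
      (𝓝 (1 / 2 * cot (a * Real.pi))) := by
  have hm := mem_integerComplement_of_sin_ne_zero ha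
  have h := tendsto_mul_tsum_exp_div_sinh hm 2 (ε := fun _ => 1) (by simp)
    (by simpa only [one_mul] using tendsto_tsum_coeff_mul_inv_add hm)
  rw [pi_mul_cot_div] at h
  simpa only [one_mul, Nat.cast_ofNat, g₁_eq] using h

lemma tendsto_h₁ {a : ℂ} (ha : sin (a * Real.pi) ≠ 0) :
    Tendsto (fun T : ℝ => (T : ℂ) * h₁ (I * T) (a * (I * T))) (𝓝[>] 0)
      (𝓝 (1 / (2 * sin (a * Real.pi)))) := by
  have hm := mem_integerComplement_of_sin_ne_zero ha
  have h := tendsto_mul_tsum_exp_div_sinh hm 1 (ε := fun j => (-1) ^ j) (by simp [norm_zpow])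
    (tendsto_tsum_neg_one_zpow_mul_coeff_mul_inv_add ha)
  have hpi : (Real.pi : ℂ) ≠ 0 := by exact_mod_cast Real.pi_pos.ne'
  have e1 : Real.pi / sin (a * Real.pi) / (2 * Real.pi) = 1 / (2 * sin (a * Real.pi)) := by
    field_simp
  rw [e1] at h
  simpa only [one_mul, Nat.cast_one, h₁_eq] using h

lemma tendsto_f₃ (a : ℂ) :
    Tendsto (fun T : ℝ => (T : ℂ) * exp (Real.pi / (4 * T)) * f₃ (I * T) (a * (I * T))) (𝓝[>] 0)
      (𝓝 (sin (a * Real.pi))) := by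
  simpa only [f₃_eq] using tendsto_mul_tsum_exp_div_cosh a

lemma tendsto_g₂ (a : ℂ) :
    Tendsto (fun T : ℝ => (T : ℂ) * exp (Real.pi / (4 * T)) * g₂ (I * T) (a * (I * T))) (𝓝[>] 0)
      (𝓝 (-cos (a * Real.pi))) := by
  simpa only [g₂_eq] using tendsto_mul_tsum_exp_two_mul_div_cosh a

lemma tendsto_h₃ (a : ℂ) :
    Tendsto (fun T : ℝ => (√T : ℂ) * h₃ (I * T) (a * (I * T))) (𝓝[>] 0) (𝓝 (1 / 2)) := by
  simpa only [h₃_eq] using tendsto_sqrt_mul_tsum_exp_div_cosh a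

lemma sin_add_half_mul_pi (a : ℂ) : sin ((a + 1 / 2) * Real.pi) = cos (a * Real.pi) := by
  rw [← Complex.sin_add_pi_div_two]; congr 1; ring

lemma cos_add_half_mul_pi (a : ℂ) : cos ((a + 1 / 2) * Real.pi) = -sin (a * Real.pi) := by
  rw [← Complex.cos_add_pi_div_two]; congr 1; ring

lemma half_cot_add_half_mul_pi (a : ℂ) :
    1 / 2 * cot ((a + 1 / 2) * Real.pi) = -(1 / 2) * tan (a * Real.pi) := by
  rw [cot_eq_cos_div_sin, sin_add_half_mul_pi, cos_add_half_mul_pi, tan_eq_sin_div_cos]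
  ring

end Appell

end

theorem mainTheorem7 (a : ℂ) :
    -- the functions whose denominators contain `1 - e^{2πiz} q^j`: `a` is not an integer
    (Complex.sin (a * Real.pi) ≠ 0 →
      Appell.LeadingAsymptotics (fun τ => Appell.f₁ τ (a * τ))
        (1 / 2 * Complex.cot (a * Real.pi)) (fun τ => (-Complex.I * τ)⁻¹) ∧
      Appell.LeadingAsymptotics (fun τ => Appell.g₁ τ (a * τ))
        (1 / 2 * Complex.cot (a * Real.pi)) (fun τ => (-Complex.I * τ)⁻¹) ∧
      Appell.LeadingAsymptotics (fun τ => Appell.h₁ τ (a * τ))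
        (1 / (2 * Complex.sin (a * Real.pi))) (fun τ => (-Complex.I * τ)⁻¹)) ∧
    -- those with `1 - e^{2πiz} q^{j+1/2}`: `a + 1/2` is not an integer
    (Complex.cos (a * Real.pi) ≠ 0 →
      Appell.LeadingAsymptotics (fun τ => Appell.f₄ τ (a * τ))
        (-(1 / 2) * Complex.tan (a * Real.pi)) (fun τ => (-Complex.I * τ)⁻¹) ∧
      Appell.LeadingAsymptotics (fun τ => Appell.g₃ τ (a * τ))
        (-(1 / 2) * Complex.tan (a * Real.pi)) (fun τ => (-Complex.I * τ)⁻¹) ∧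
      Appell.LeadingAsymptotics (fun τ => Appell.h₂ τ (a * τ))
        (1 / (2 * Complex.cos (a * Real.pi))) (fun τ => (-Complex.I * τ)⁻¹)) ∧
    -- the remaining ones, for every complex `a`
    Appell.LeadingAsymptotics (fun τ => Appell.f₂ τ (a * τ)) (Complex.cos (a * Real.pi))
      (fun τ => (-Complex.I * τ)⁻¹ * Complex.exp (-(Real.pi * Complex.I) / (4 * τ))) ∧
    Appell.LeadingAsymptotics (fun τ => Appell.f₃ τ (a * τ)) (Complex.sin (a * Real.pi))
      (fun τ => (-Complex.I * τ)⁻¹ * Complex.exp (-(Real.pi * Complex.I) / (4 * τ))) ∧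
    Appell.LeadingAsymptotics (fun τ => Appell.g₂ τ (a * τ)) (-Complex.cos (a * Real.pi))
      (fun τ => (-Complex.I * τ)⁻¹ * Complex.exp (-(Real.pi * Complex.I) / (4 * τ))) ∧
    Appell.LeadingAsymptotics (fun τ => Appell.g₄ τ (a * τ)) (Complex.sin (a * Real.pi))
      (fun τ => (-Complex.I * τ)⁻¹ * Complex.exp (-(Real.pi * Complex.I) / (4 * τ))) ∧
    Appell.LeadingAsymptotics (fun τ => Appell.h₃ τ (a * τ)) (1 / 2)
      (fun τ => (-Complex.I * τ) ^ (-(1 / 2) : ℂ)) ∧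
    Appell.LeadingAsymptotics (fun τ => Appell.h₄ τ (a * τ)) (1 / 2)
      (fun τ => (-Complex.I * τ) ^ (-(1 / 2) : ℂ)) := by
  open Appell in
  refine ⟨fun ha => ⟨leadingAsymptotics_inv (tendsto_f₁ ha), leadingAsymptotics_inv (tendsto_g₁ ha),
    leadingAsymptotics_inv (tendsto_h₁ ha)⟩, fun ha => ?_, ?_,
    leadingAsymptotics_inv_mul_exp (tendsto_f₃ a),
    leadingAsymptotics_inv_mul_exp (tendsto_g₂ a), ?_, leadingAsymptotics_cpow (tendsto_h₃ a), ?_⟩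
  · have ha' : Complex.sin ((a + 1 / 2) * Real.pi) ≠ 0 := by rwa [sin_add_half_mul_pi]
    -- The half-index functions are those of the first group at `a + 1/2`, so the constants are
    -- rewritten as values there.
    rw [← half_cot_add_half_mul_pi, ← sin_add_half_mul_pi]
    exact ⟨leadingAsymptotics_inv (tendsto_mul_exp_mul (fun T => f₄_eq T a) (tendsto_f₁ ha')),
      leadingAsymptotics_inv (tendsto_mul_exp_mul (fun T => g₃_eq T a) (tendsto_g₁ ha')),
      leadingAsymptotics_inv (tendsto_mul_exp_mul (fun T => h₂_eq T a) (tendsto_h₁ ha'))⟩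
  · rw [← sin_add_half_mul_pi]
    exact leadingAsymptotics_inv_mul_exp
      (tendsto_mul_exp_mul (fun T => f₂_eq T a) (tendsto_f₃ (a + 1 / 2)))
  · have h := tendsto_g₂ (a + 1 / 2)
    rw [cos_add_half_mul_pi, neg_neg] at h
    exact leadingAsymptotics_inv_mul_exp (tendsto_mul_exp_mul (fun T => g₄_eq T a) h)
  · exact leadingAsymptotics_cpow
      (tendsto_mul_exp_mul (fun T => h₄_eq T a) (tendsto_h₃ (a + 1 / 2)))
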